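/- Notation. For an integer $k\ge 1$ let $\omega^{\le k}$ (resp. $\omega^{k}$) be the set of non-decreasing sequences of natural numbers of length at most $k$ (resp. exactly $k$), including the empty sequence in the first case. Write $s\sqsubset t$ if $s$ is a proper initial segment of $t$. Order $\omega^{\le k}$ by $\prec$: the empty sequence is the minimum, and for nonempty sequences $(s_1,\dots,s_i)\prec(t_1,\dots,t_j)$ iff $s_i<t_j$, or $s_i=t_j$ and $(s_1,\dots,s_i)$ is lexicographically below $(t_1,\dots,t_j)$ (a proper initial segment being below the longer sequence). An $\mathcal E_k$-tree is a map $\widehat X:\omega^{\le k}\to\omega^{\le k}$ preserving $\prec$ and $\sqsubset$; such a map preserves lengths. Let $\mathcal{AR}^k$ be the family of all nonempty finite sets consisting of the $\prec$-least $n$ elements of $\widehat X(\omega^{k})$ for some $\mathcal E_k$-tree $\widehat X$ and some $n\ge 1$. For finite nonempty $E,F\subset\omega^{k}$ write $E<F$ if $\max_\prec E\prec\min_\prec F$. Let $d\ge 1$ be an integer and $0<\theta<1$. A sequence $(E_i)_{i=1}^m$ in $\mathcal{AR}^k$ is admissible if $1\le m\le d$ and $E_1<\dots<E_m$. On the space $c_{00}(\omega^{k})$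 of finitely supported functions $x:\omega^{k}\to\mathbb R$ put $|x|_0=\max_v|x_v|$ and $$|x|_{j+1}=\max\Big\{|x|_j,\ \theta\max\Big\{\sum_{i=1}^m|E_ix|_j:(E_i)_{i=1}^m\text{ admissible}\Big\}\Big\},$$ where $E x$ is the restriction of $x$ to $E$ (extended by $0$), and let $\|x\|=\sup_j|x|_j$. The real Banach space $T_k(d,\theta)$ is the completion of $(c_{00}(\omega^{k}),\|\cdot\|)$. Theorem. Let $k\ge 1$, $d\ge 1$ be integers and $0<\theta<1$ with $d\theta>1$, and let $p\in(1,\infty)$ be determined by $d\theta=d^{1/p}$. Then every infinite-dimensional closed subspace $Z$ of $T_k(d,\theta)$ contains a closed subspace $Y\subseteq Z$ that is (linearly) isomorphic to the real space $\ell_p$. -/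

import Mathlib

namespace HighDimEllentuck

/-- `ω^{≤ k}`: the non-decreasing sequences of natural numbers of length at most `k`. -/
abbrev OmegaLE (k : ℕ) : Type := {s : List ℕ // s.Pairwise (· ≤ ·) ∧ s.length ≤ k}

/-- `ω^{k}`: the non-decreasing sequences of natural numbers of length exactly `k`. -/
abbrev OmegaEQ (k : ℕ) : Type := {s : List ℕ // s.Pairwise (· ≤ ·) ∧ s.length = k}

/-- A sequence of length `k` is a sequence of length at most `k`. -/
def OmegaEQ.toLE {k : ℕ} (v : OmegaEQ k) : OmegaLE k := ⟨v.1, v.2.1, v.2.2.le⟩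

/-- The order `≺`. The empty sequence is the minimum; nonempty sequences are compared by their last
entries, and if these agree, lexicographically (`<` on `List ℕ` is the lexicographic order, in which
a proper initial segment of a sequence is below that sequence). -/
def Prec (s t : List ℕ) : Prop :=
  (s = [] ∧ t ≠ []) ∨
    ∃ (hs : s ≠ []) (ht : t ≠ []),
      s.getLast hs < t.getLast ht ∨ (s.getLast hs = t.getLast ht ∧ s < t)

/-- The relation `s ⊏ t`: `s` is a proper initial segment of `t`. -/
def InitSeg (s t : List ℕ) : Prop := s <+: t ∧ s.length < t.length

/-- `𝓔_k`-trees: the maps of `ω^{≤ k}` to itself that preserve `≺` and `⊏`. -/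
def IsTree {k : ℕ} (f : OmegaLE k → OmegaLE k) : Prop :=
  (∀ s t : OmegaLE k, Prec s.1 t.1 → Prec (f s).1 (f t).1) ∧
    (∀ s t : OmegaLE k, InitSeg s.1 t.1 → InitSeg (f s).1 (f t).1)

/-- The space `𝓔_k`: its members are the restrictions to `ω^{k}` of the `𝓔_k`-trees, identified
with their ranges (an `𝓔_k`-tree preserves lengths, so it maps `ω^{k}` into `ω^{k}`). -/
def ESpace (k : ℕ) : Set (Set (OmegaEQ k)) :=
  {X | ∃ f : OmegaLE k → OmegaLE k, IsTree f ∧ X = {v | ∃ u : OmegaEQ k, f u.toLE = v.toLE}}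

/-- `E = r_n(X)`: the set `E` consists of the `≺`-least `n` members of `X`. -/
def IsRestr {k : ℕ} (n : ℕ) (X : Set (OmegaEQ k)) (E : Finset (OmegaEQ k)) : Prop :=
  (E : Set (OmegaEQ k)) ⊆ X ∧ E.card = n ∧ ∀ v ∈ E, ∀ w ∈ X, w ∉ E → Prec v.1 w.1

/-- `𝓐𝓡^k`: the (nonempty) finite approximations to members of `𝓔_k`. -/
def AR (k : ℕ) : Set (Finset (OmegaEQ k)) :=
  {E | E.Nonempty ∧ ∃ X ∈ ESpace k, ∃ n : ℕ, IsRestr n X E}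

/-- `E < F`: the `≺`-maximum of `E` lies strictly below the `≺`-minimum of `F`. -/
def Below {k : ℕ} (E F : Finset (OmegaEQ k)) : Prop := ∀ v ∈ E, ∀ w ∈ F, Prec v.1 w.1

/-- The sequence `E_1, …, E_m` of members of `𝓐𝓡^k` is `d`-admissible: `1 ≤ m ≤ d` and
`E_1 < E_2 < ⋯ < E_m`. -/
def Admissible {k : ℕ} (d : ℕ) {m : ℕ} (E : Fin m → Finset (OmegaEQ k)) : Prop :=
  1 ≤ m ∧ m ≤ d ∧ (∀ i, E i ∈ AR k) ∧ ∀ i j, i < j → Below (E i) (E j)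

/-- `E x = ∑_{v ∈ E} x_v e_v`. -/
noncomputable def restrict {k : ℕ} (E : Finset (OmegaEQ k)) (x : OmegaEQ k →₀ ℝ) :
    OmegaEQ k →₀ ℝ :=
  x.filter (· ∈ E)

/-- The norms `|x|_j` on `c₀₀(ω^{k})`. The suprema are maxima: `x` has finite support, so each of
the sets involved has only finitely many elements. -/
noncomputable def normSeq (k d : ℕ) (θ : ℝ) : ℕ → (OmegaEQ k →₀ ℝ) → ℝ
  | 0, x => ⨆ v, |x v|
  | j + 1, x => max (normSeq k d θ j x)
      (θ * sSup {r : ℝ | ∃ (m : ℕ) (E : Fin m → Finset (OmegaEQ k)),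
        Admissible d E ∧ r = ∑ i, normSeq k d θ j (restrict (E i) x)})

/-- `‖x‖ = sup_j |x|_j` on `c₀₀(ω^{k})`. -/
noncomputable def tkNorm (k d : ℕ) (θ : ℝ) (x : OmegaEQ k →₀ ℝ) : ℝ :=
  ⨆ j, normSeq k d θ j x

/-! ### The function `‖·‖` is a norm -/

/-- The `ℓ₁`-norm on `c₀₀(ω^{k})`. -/
noncomputable def ellOne {k : ℕ} (x : OmegaEQ k →₀ ℝ) : ℝ := ∑ v ∈ x.support, |x v|

theorem prec_irrefl (s : List ℕ) : ¬ Prec s s := by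
  rintro (⟨h, h'⟩ | ⟨_, _, h | ⟨_, h⟩⟩)
  · exact h' h
  · exact lt_irrefl _ h
  · exact lt_irrefl _ h

theorem bddAbove_abs {k : ℕ} (x : OmegaEQ k →₀ ℝ) :
    BddAbove (Set.range fun v => |x v|) := by
  refine ⟨ellOne x, ?_⟩
  rintro _ ⟨v, rfl⟩
  by_cases hv : v ∈ x.support
  · exact Finset.single_le_sum (f := fun v => |x v|) (fun _ _ => abs_nonneg _) hv
  · have : x v = 0 := by simpa using hv
    simp only [this, abs_zero]
    exact Finset.sum_nonneg fun _ _ => abs_nonneg _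

instance (k : ℕ) : Nonempty (OmegaEQ k) :=
  ⟨⟨List.replicate k 0, by simp [List.pairwise_replicate], by simp⟩⟩

theorem ellOne_nonneg {k : ℕ} (x : OmegaEQ k →₀ ℝ) : 0 ≤ ellOne x :=
  Finset.sum_nonneg fun _ _ => abs_nonneg _

theorem ellOne_restrict {k : ℕ} (E : Finset (OmegaEQ k)) (x : OmegaEQ k →₀ ℝ) :
    ellOne (restrict E x) = ∑ v ∈ x.support, if v ∈ E then |x v| else 0 := by
  unfold ellOne restrict
  rw [Finsupp.support_filter, Finset.sum_filter]
  refine Finset.sum_congr rfl fun v _ => ?_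
  split_ifs with h
  · rw [Finsupp.filter_apply_pos _ _ h]
  · rfl

theorem sum_ellOne_restrict_le {k d m : ℕ} {E : Fin m → Finset (OmegaEQ k)}
    (hE : Admissible d E) (x : OmegaEQ k →₀ ℝ) :
    ∑ i, ellOne (restrict (E i) x) ≤ ellOne x := by
  simp only [ellOne_restrict]
  rw [Finset.sum_comm]
  refine Finset.sum_le_sum fun v _ => ?_
  by_cases h : ∃ i, v ∈ E i
  · obtain ⟨i, hi⟩ := h
    rw [Finset.sum_eq_single i]
    · simp [hi]
    · intro j _ hji
      rw [if_neg]
      intro hj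
      rcases lt_or_gt_of_ne hji with h | h
      · exact prec_irrefl _ (hE.2.2.2 j i h v hj v hi)
      · exact prec_irrefl _ (hE.2.2.2 i j h v hi v hj)
    · simp
  · push Not at h
    simp [h]

theorem restrict_add {k : ℕ} (E : Finset (OmegaEQ k)) (x y : OmegaEQ k →₀ ℝ) :
    restrict E (x + y) = restrict E x + restrict E y := Finsupp.filter_add

theorem restrict_smul {k : ℕ} (E : Finset (OmegaEQ k)) (c : ℝ) (x : OmegaEQ k →₀ ℝ) :
    restrict E (c • x) = c • restrict E x := Finsupp.filter_smul

theorem normSeq_props (k d : ℕ) {θ : ℝ} (hθ : θ ∈ Set.Ioo (0 : ℝ) 1) (j : ℕ) :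
    (∀ x, 0 ≤ normSeq k d θ j x) ∧ (∀ x, normSeq k d θ j x ≤ ellOne x) ∧
      (∀ (c : ℝ) (x), normSeq k d θ j (c • x) ≤ |c| * normSeq k d θ j x) ∧
      (∀ x y, normSeq k d θ j (x + y) ≤ normSeq k d θ j x + normSeq k d θ j y) := by
  induction j with
  | zero =>
    simp only [normSeq]
    refine ⟨fun x => Real.iSup_nonneg fun _ => abs_nonneg _, fun x => ciSup_le fun v => ?_,
      fun c x => ciSup_le fun v => ?_, fun x y => ciSup_le fun v => ?_⟩
    · by_cases hv : v ∈ x.support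
      · exact Finset.single_le_sum (f := fun v => |x v|) (fun _ _ => abs_nonneg _) hv
      · have : x v = 0 := by simpa using hv
        simpa only [this, abs_zero] using ellOne_nonneg x
    · rw [Finsupp.smul_apply, smul_eq_mul, abs_mul]
      exact mul_le_mul_of_nonneg_left (le_ciSup (bddAbove_abs x) v) (abs_nonneg c)
    · exact (abs_add_le _ _).trans
        (add_le_add (le_ciSup (bddAbove_abs x) v) (le_ciSup (bddAbove_abs y) v))
  | succ j ih =>
    obtain ⟨h0, h1, hs, ha⟩ := ih
    set S : (OmegaEQ k →₀ ℝ) → Set ℝ := fun x =>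
      {r : ℝ | ∃ (m : ℕ) (E : Fin m → Finset (OmegaEQ k)),
        Admissible d E ∧ r = ∑ i, normSeq k d θ j (restrict (E i) x)} with hS
    have hdef : ∀ x, normSeq k d θ (j + 1) x = max (normSeq k d θ j x) (θ * sSup (S x)) :=
      fun x => rfl
    have hle : ∀ x, ∀ r ∈ S x, r ≤ ellOne x := by
      rintro x r ⟨m, E, hE, rfl⟩
      exact (Finset.sum_le_sum fun i _ => h1 _).trans (sum_ellOne_restrict_le hE x)
    have hbdd : ∀ x, BddAbove (S x) := fun x => ⟨ellOne x, hle x⟩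
    have hS0 : ∀ x, 0 ≤ sSup (S x) := fun x => by
      refine Real.sSup_nonneg ?_
      rintro r ⟨m, E, hE, rfl⟩
      exact Finset.sum_nonneg fun i _ => h0 _
    simp only [hdef]
    refine ⟨fun x => le_max_of_le_left (h0 x), fun x => max_le (h1 x) ?_,
      fun c x => max_le ?_ ?_, fun x y => max_le ?_ ?_⟩
    · have h2 : sSup (S x) ≤ ellOne x := Real.sSup_le (hle x) (ellOne_nonneg x)
      nlinarith [hθ.1, hθ.2, hS0 x]
    · exact (hs c x).trans (mul_le_mul_of_nonneg_left (le_max_left _ _) (abs_nonneg c))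
    · have h2 : sSup (S (c • x)) ≤ |c| * sSup (S x) := by
        refine Real.sSup_le ?_ (mul_nonneg (abs_nonneg c) (hS0 x))
        rintro r ⟨m, E, hE, rfl⟩
        calc ∑ i, normSeq k d θ j (restrict (E i) (c • x))
            ≤ ∑ i, |c| * normSeq k d θ j (restrict (E i) x) :=
              Finset.sum_le_sum fun i _ => by rw [restrict_smul]; exact hs c _
          _ = |c| * ∑ i, normSeq k d θ j (restrict (E i) x) := by rw [Finset.mul_sum]
          _ ≤ |c| * sSup (S x) :=
              mul_le_mul_of_nonneg_left (le_csSup (hbdd x) ⟨m, E, hE, rfl⟩) (abs_nonneg c)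
      calc θ * sSup (S (c • x)) ≤ θ * (|c| * sSup (S x)) :=
            mul_le_mul_of_nonneg_left h2 hθ.1.le
        _ = |c| * (θ * sSup (S x)) := by ring
        _ ≤ _ := mul_le_mul_of_nonneg_left (le_max_right _ _) (abs_nonneg c)
    · exact (ha x y).trans (add_le_add (le_max_left _ _) (le_max_left _ _))
    · have h2 : sSup (S (x + y)) ≤ sSup (S x) + sSup (S y) := by
        refine Real.sSup_le ?_ (add_nonneg (hS0 x) (hS0 y))
        rintro r ⟨m, E, hE, rfl⟩
        calc ∑ i, normSeq k d θ j (restrict (E i) (x + y))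
            ≤ ∑ i, (normSeq k d θ j (restrict (E i) x) + normSeq k d θ j (restrict (E i) y)) :=
              Finset.sum_le_sum fun i _ => by rw [restrict_add]; exact ha _ _
          _ = ∑ i, normSeq k d θ j (restrict (E i) x) +
                ∑ i, normSeq k d θ j (restrict (E i) y) := Finset.sum_add_distrib
          _ ≤ _ := add_le_add (le_csSup (hbdd x) ⟨m, E, hE, rfl⟩)
              (le_csSup (hbdd y) ⟨m, E, hE, rfl⟩)
      calc θ * sSup (S (x + y)) ≤ θ * (sSup (S x) + sSup (S y)) :=
            mul_le_mul_of_nonneg_left h2 hθ.1.le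
        _ = θ * sSup (S x) + θ * sSup (S y) := by ring
        _ ≤ _ := add_le_add (le_max_right _ _) (le_max_right _ _)

theorem bddAbove_normSeq (k d : ℕ) {θ : ℝ} (hθ : θ ∈ Set.Ioo (0 : ℝ) 1)
    (x : OmegaEQ k →₀ ℝ) : BddAbove (Set.range fun j => normSeq k d θ j x) := by
  refine ⟨ellOne x, ?_⟩
  rintro _ ⟨j, rfl⟩
  exact (normSeq_props k d hθ j).2.1 x

theorem tkNorm_smul_le (k d : ℕ) {θ : ℝ} (hθ : θ ∈ Set.Ioo (0 : ℝ) 1) (c : ℝ)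
    (x : OmegaEQ k →₀ ℝ) : tkNorm k d θ (c • x) ≤ |c| * tkNorm k d θ x :=
  ciSup_le fun j => ((normSeq_props k d hθ j).2.2.1 c x).trans
    (mul_le_mul_of_nonneg_left (le_ciSup (bddAbove_normSeq k d hθ x) j) (abs_nonneg c))

theorem tkNorm_add_le (k d : ℕ) {θ : ℝ} (hθ : θ ∈ Set.Ioo (0 : ℝ) 1)
    (x y : OmegaEQ k →₀ ℝ) : tkNorm k d θ (x + y) ≤ tkNorm k d θ x + tkNorm k d θ y :=
  ciSup_le fun j => ((normSeq_props k d hθ j).2.2.2 x y).trans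
    (add_le_add (le_ciSup (bddAbove_normSeq k d hθ x) j)
      (le_ciSup (bddAbove_normSeq k d hθ y) j))

theorem abs_le_tkNorm (k d : ℕ) {θ : ℝ} (hθ : θ ∈ Set.Ioo (0 : ℝ) 1)
    (x : OmegaEQ k →₀ ℝ) (v : OmegaEQ k) : |x v| ≤ tkNorm k d θ x :=
  (le_ciSup (bddAbove_abs x) v).trans (le_ciSup (bddAbove_normSeq k d hθ x) 0)

/-- The space `c₀₀(ω^{k})`, to be equipped with the norm of `T_k(d, θ)`. -/
def C00 (k _d : ℕ) (_θ : Set.Ioo (0 : ℝ) 1) : Type := OmegaEQ k →₀ ℝ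

noncomputable instance (k d : ℕ) (θ : Set.Ioo (0 : ℝ) 1) : AddCommGroup (C00 k d θ) :=
  inferInstanceAs (AddCommGroup (OmegaEQ k →₀ ℝ))

noncomputable instance (k d : ℕ) (θ : Set.Ioo (0 : ℝ) 1) : Module ℝ (C00 k d θ) :=
  inferInstanceAs (Module ℝ (OmegaEQ k →₀ ℝ))

/-- The norm of `T_k(d, θ)` on `c₀₀(ω^{k})`. -/
noncomputable def c00Norm (k d : ℕ) (θ : Set.Ioo (0 : ℝ) 1) : AddGroupNorm (C00 k d θ) where
  toFun := tkNorm k d θ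
  map_zero' := by
    have h := tkNorm_smul_le k d θ.2 0 0
    rw [zero_smul, abs_zero, zero_mul] at h
    exact le_antisymm h ((abs_nonneg _).trans
      (abs_le_tkNorm k d θ.2 0 (Classical.arbitrary _)))
  add_le' := tkNorm_add_le k d θ.2
  neg' := by
    have h : ∀ x : OmegaEQ k →₀ ℝ, tkNorm k d θ (-x) ≤ tkNorm k d θ x := fun x => by
      simpa using tkNorm_smul_le k d θ.2 (-1) x
    intro x
    refine le_antisymm (h x) ?_
    have h' := h (-(show OmegaEQ k →₀ ℝ from x))
    rw [neg_neg] at h'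
    exact h'
  eq_zero_of_map_eq_zero' := by
    intro x hx
    refine Finsupp.ext fun v => ?_
    have h := abs_le_tkNorm k d θ.2 x v
    rw [hx] at h
    exact abs_nonpos_iff.1 h

noncomputable instance (k d : ℕ) (θ : Set.Ioo (0 : ℝ) 1) : NormedAddCommGroup (C00 k d θ) :=
  (c00Norm k d θ).toNormedAddCommGroup

noncomputable instance (k d : ℕ) (θ : Set.Ioo (0 : ℝ) 1) : NormedSpace ℝ (C00 k d θ) where
  norm_smul_le c x := tkNorm_smul_le k d θ.2 c x

/-- The Banach space `T_k(d, θ)`: the completion of `c₀₀(ω^{k})` with respect to `‖·‖`. -/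
abbrev T (k d : ℕ) (θ : Set.Ioo (0 : ℝ) 1) : Type := UniformSpace.Completion (C00 k d θ)

end HighDimEllentuck

namespace HighDimEllentuck

/-! ### Lattice properties of the norm -/

/-! The space behaves like a Tsirelson-type space with a bounded number `d` of admissible sets, for
which the exponent `p` is determined by `d * θ = d ^ (1 / p)`, i.e. `θ = d ^ (-(1 - 1 / p))`. It
suffices to find in `Z` a sequence equivalent to the unit vector basis of `ℓ_p`; the span is then
handled by `exists_submodule_equiv_lp`.

Every bounded block sequence has an upper `ℓ_p`-estimate (`tkNorm_le_of_blocks`). This uses only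
that admissible sets are successive and at most `d` in number: one application of the norming
equation costs nothing, by Hölder, provided that the blocks are shared out among the sets without
overcounting. Since a set may cut a block, each block gets a multiplicity, and multiplicity 2 is
enough.

The lower estimate (`rpow_sum_le_of_split`) comes from an explicit functional: divide the unit
interval into pieces proportional to the `p`-th powers of the coefficients, and split it repeatedly
into `d` equal parts until each point is alone. The depth at which this happens is the power of `θ`
in front of the block, and it is the right one up to a constant. Here the pieces must be covered by
successive members of `AR k`. For vectors living on the extensions of one fixed stem `s`, with all
further entries large, such sets are finite approximations to the tree `shiftTree`
(`exists_mem_AR`).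

It remains to find in `Z` almost-block vectors with a component of norm at least `δ` on the tails of
a single stem (`exists_stem`). Take `j` maximal such that projecting to the sequences with `j`
bounded entries is bounded below on some infinite-dimensional subspace. This fails for `j = k`,
where the projection has finite rank. Vectors that are small where `j + 1` entries are bounded, but
not where `j` are, must be large on the extensions of one of finitely many stems of length `j`.
Discarding all other coordinates does not increase the norm, so the lower estimate transfers to the
whole vectors, while the upper estimate holds for them anyway. A small perturbation brings the
sequence back into `Z`. -/

/-- The restriction of a finitely supported function to a set of coordinates. -/
noncomputable def proj {k : ℕ} (A : Set (OmegaEQ k)) :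
    (OmegaEQ k →₀ ℝ) →ₗ[ℝ] (OmegaEQ k →₀ ℝ) :=
  open scoped Classical in
  { toFun := fun x => x.filter (· ∈ A)
    map_add' := fun _ _ => Finsupp.filter_add
    map_smul' := fun _ _ => Finsupp.filter_smul }

open scoped Classical in
theorem proj_apply {k : ℕ} (A : Set (OmegaEQ k)) (x : OmegaEQ k →₀ ℝ) (v : OmegaEQ k) :
    proj A x v = if v ∈ A then x v else 0 :=
  Finsupp.filter_apply _ _ _

theorem proj_apply_ne_zero {k : ℕ} {A : Set (OmegaEQ k)} {x : OmegaEQ k →₀ ℝ} {v : OmegaEQ k} :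
    proj A x v ≠ 0 ↔ v ∈ A ∧ x v ≠ 0 := by
  rw [proj_apply]; split_ifs with h <;> simp [h]

theorem restrict_eq_proj {k : ℕ} (E : Finset (OmegaEQ k)) (x : OmegaEQ k →₀ ℝ) :
    restrict E x = proj (E : Set (OmegaEQ k)) x := by
  ext v
  rw [proj_apply, restrict, Finsupp.filter_apply]
  simp only [Finset.mem_coe]

theorem proj_proj {k : ℕ} (A B : Set (OmegaEQ k)) (x : OmegaEQ k →₀ ℝ) :
    proj A (proj B x) = proj (A ∩ B) x := by
  ext v
  by_cases hA : v ∈ A <;> by_cases hB : v ∈ B <;> simp [proj_apply, hA, hB]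

theorem proj_eq_self {k : ℕ} {A : Set (OmegaEQ k)} {x : OmegaEQ k →₀ ℝ}
    (h : ∀ v, x v ≠ 0 → v ∈ A) : proj A x = x := by
  ext v
  rw [proj_apply]
  split_ifs with hv
  · rfl
  · by_contra h0
    exact hv (h v (Ne.symm h0))

theorem proj_eq_zero {k : ℕ} {A : Set (OmegaEQ k)} {x : OmegaEQ k →₀ ℝ}
    (h : ∀ v ∈ A, x v = 0) : proj A x = 0 := by
  ext v
  rw [proj_apply]
  split_ifs with hv
  · rw [h v hv]; rfl
  · rfl

theorem proj_congr {k : ℕ} {A B : Set (OmegaEQ k)} {x : OmegaEQ k →₀ ℝ}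
    (h : ∀ v, x v ≠ 0 → (v ∈ A ↔ v ∈ B)) : proj A x = proj B x := by
  ext v
  rw [proj_apply, proj_apply]
  by_cases hv : x v = 0
  · rw [hv, ite_self, ite_self]
  · by_cases hB : v ∈ B
    · rw [if_pos hB, if_pos ((h v hv).2 hB)]
    · rw [if_neg hB, if_neg fun hA => hB ((h v hv).1 hA)]

/-- `|E x|_j` summed over an admissible sequence is bounded by `|x|_{j+1}`. -/
theorem sum_normSeq_restrict_le {k d : ℕ} {θ : ℝ} (hθ : θ ∈ Set.Ioo (0 : ℝ) 1) (j : ℕ)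
    (x : OmegaEQ k →₀ ℝ) {m : ℕ} {E : Fin m → Finset (OmegaEQ k)} (hE : Admissible d E) :
    θ * ∑ i, normSeq k d θ j (restrict (E i) x) ≤ normSeq k d θ (j + 1) x := by
  refine le_trans ?_ (le_max_right _ _)
  refine mul_le_mul_of_nonneg_left (le_csSup ⟨ellOne x, ?_⟩ ⟨m, E, hE, rfl⟩) hθ.1.le
  rintro r ⟨m, E, hE, rfl⟩
  exact (Finset.sum_le_sum fun i _ => (normSeq_props k d hθ j).2.1 _).trans
    (sum_ellOne_restrict_le hE x)

/-- To bound `|x|_{j+1}` it suffices to bound `|x|_j` and all admissible sums. -/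
theorem normSeq_succ_le {k d : ℕ} {θ : ℝ} (hθ : θ ∈ Set.Ioo (0 : ℝ) 1) {j : ℕ}
    {x : OmegaEQ k →₀ ℝ} {r : ℝ} (hx : normSeq k d θ j x ≤ r)
    (h : ∀ (m : ℕ) (E : Fin m → Finset (OmegaEQ k)), Admissible d E →
      θ * ∑ i, normSeq k d θ j (restrict (E i) x) ≤ r) :
    normSeq k d θ (j + 1) x ≤ r := by
  have hr : 0 ≤ r := ((normSeq_props k d hθ j).1 x).trans hx
  refine max_le hx ?_
  rw [← le_div_iff₀' hθ.1]
  refine Real.sSup_le ?_ (div_nonneg hr hθ.1.le)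
  rintro _ ⟨m, E, hE, rfl⟩
  rw [le_div_iff₀' hθ.1]
  exact h m E hE

/-- Unconditionality of the unit vectors. It makes all coordinate projections contractive, so
coordinates may be discarded freely in lower estimates. -/
theorem normSeq_le_of_abs_le {k d : ℕ} {θ : ℝ} (hθ : θ ∈ Set.Ioo (0 : ℝ) 1) (j : ℕ)
    {x y : OmegaEQ k →₀ ℝ} (h : ∀ v, |x v| ≤ |y v|) :
    normSeq k d θ j x ≤ normSeq k d θ j y := by
  induction j generalizing x y with
  | zero => exact ciSup_mono (bddAbove_abs y) h
  | succ j ih =>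
    refine normSeq_succ_le hθ ((ih h).trans (le_max_left _ _)) fun m E hE => ?_
    refine le_trans ?_ (sum_normSeq_restrict_le hθ j y hE)
    refine mul_le_mul_of_nonneg_left (Finset.sum_le_sum fun i _ => ih fun v => ?_) hθ.1.le
    rw [restrict_eq_proj, restrict_eq_proj, proj_apply, proj_apply]
    split_ifs
    · exact h v
    · exact le_rfl

theorem normSeq_proj_le {k d : ℕ} {θ : ℝ} (hθ : θ ∈ Set.Ioo (0 : ℝ) 1) (j : ℕ)
    (A : Set (OmegaEQ k)) (x : OmegaEQ k →₀ ℝ) :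
    normSeq k d θ j (proj A x) ≤ normSeq k d θ j x := by
  refine normSeq_le_of_abs_le hθ j fun v => ?_
  rw [proj_apply]
  split_ifs <;> simp

theorem tkNorm_proj_le {k d : ℕ} {θ : ℝ} (hθ : θ ∈ Set.Ioo (0 : ℝ) 1)
    (A : Set (OmegaEQ k)) (x : OmegaEQ k →₀ ℝ) :
    tkNorm k d θ (proj A x) ≤ tkNorm k d θ x :=
  ciSup_mono (bddAbove_normSeq k d hθ x) fun j => normSeq_proj_le hθ j A x

theorem normSeq_le_tkNorm {k d : ℕ} {θ : ℝ} (hθ : θ ∈ Set.Ioo (0 : ℝ) 1) (j : ℕ)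
    (x : OmegaEQ k →₀ ℝ) : normSeq k d θ j x ≤ tkNorm k d θ x :=
  le_ciSup (bddAbove_normSeq k d hθ x) j

theorem tkNorm_nonneg {k d : ℕ} {θ : ℝ} (hθ : θ ∈ Set.Ioo (0 : ℝ) 1) (x : OmegaEQ k →₀ ℝ) :
    0 ≤ tkNorm k d θ x :=
  ((normSeq_props k d hθ 0).1 x).trans (normSeq_le_tkNorm hθ 0 x)

theorem normSeq_zero {k d : ℕ} {θ : ℝ} (hθ : θ ∈ Set.Ioo (0 : ℝ) 1) (j : ℕ) :
    normSeq k d θ j 0 = 0 :=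
  le_antisymm (by simpa using (normSeq_props k d hθ j).2.2.1 0 0) ((normSeq_props k d hθ j).1 0)

theorem normSeq_sum_le {k d : ℕ} {θ : ℝ} (hθ : θ ∈ Set.Ioo (0 : ℝ) 1) (j : ℕ) {ι : Type*}
    (s : Finset ι) (x : ι → OmegaEQ k →₀ ℝ) :
    normSeq k d θ j (∑ i ∈ s, x i) ≤ ∑ i ∈ s, normSeq k d θ j (x i) := by
  classical
  induction s using Finset.induction_on with
  | empty => simp [normSeq_zero hθ]
  | insert a s ha ih =>
    rw [Finset.sum_insert ha, Finset.sum_insert ha]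
    exact ((normSeq_props k d hθ j).2.2.2 _ _).trans (by gcongr)

/-- The lower estimate in the implicit equation satisfied by the norm. -/
theorem sum_tkNorm_restrict_le {k d : ℕ} {θ : ℝ} (hθ : θ ∈ Set.Ioo (0 : ℝ) 1)
    (x : OmegaEQ k →₀ ℝ) {m : ℕ} {E : Fin m → Finset (OmegaEQ k)} (hE : Admissible d E) :
    θ * ∑ i, tkNorm k d θ (restrict (E i) x) ≤ tkNorm k d θ x := by
  have hlim : ∀ y : OmegaEQ k →₀ ℝ, Filter.Tendsto (fun j => normSeq k d θ j y) Filter.atTop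
      (nhds (tkNorm k d θ y)) := fun y =>
    tendsto_atTop_ciSup (monotone_nat_of_le_succ fun j => le_max_left _ _)
      (bddAbove_normSeq k d hθ y)
  refine le_of_tendsto' ((tendsto_finsetSum Finset.univ fun i _ => hlim (restrict (E i) x)).const_mul θ)
    fun j => ?_
  exact (sum_normSeq_restrict_le hθ j x hE).trans (normSeq_le_tkNorm hθ _ x)

/-! ### The upper estimate -/

/-- Distribution of the multiplicities `n` of the blocks among the members of a successive family
of sets of blocks. The blocks in `D` are those which fill up a whole member of the family. -/
theorem exists_distribution {m : ℕ} (M : Fin m → Set ℕ)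
    (hM : ∀ l l', l < l' → ∀ i ∈ M l, ∀ i' ∈ M l', i ≤ i') (n : ℕ → ℕ)
    (h1 : ∀ l, ∀ i ∈ M l, 1 ≤ n i)
    (h2 : ∀ i l₁ l₂ l₃, ∀ a ∈ M l₁, i ∈ M l₂ → ∀ c ∈ M l₃, a < i → i < c → 2 ≤ n i) :
    ∃ (D : Set ℕ) (g : ℕ → Option (Fin m)) (N : Fin m → ℕ → ℕ),
      (∀ i ∈ D, ∃ l, g i = some l) ∧
      (∀ i ∈ D, ∀ l, g i = some l → M l = {i} ∧ 1 ≤ N l i) ∧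
      (∀ l, ∀ i ∈ M l, i ∉ D → 1 ≤ N l i) ∧
      (∀ l, ∀ i ∈ M l, i ∉ D → ∀ a ∈ M l, ∀ c ∈ M l, a < i → i < c → 2 ≤ N l i) ∧
      ∀ i, ∑ l, N l i ≤ n i := by
  classical
  let D : Set ℕ := {i | ∃ l, M l = {i}}
  let g : ℕ → Option (Fin m) := fun i => if h : ∃ l, M l = {i} then some h.choose else none
  have hg : ∀ i ∈ D, ∃ l, g i = some l ∧ M l = {i} := fun i hi =>
    ⟨hi.choose, dif_pos hi, hi.choose_spec⟩
  -- A block of `D` is charged once, to a single `l` with `M l = {i}`. A block outside `D` gives its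
  -- full multiplicity to the only `M l` that contains it, or one unit to each of the sets that
  -- share it.
  refine ⟨D, g, fun l i => if i ∈ D then (if g i = some l then 1 else 0) else
    if i ∉ M l then 0 else if ∃ l', l' ≠ l ∧ i ∈ M l' then 1 else n i, ?_, ?_, ?_, ?_, ?_⟩
  · intro i hi
    obtain ⟨l, hl, -⟩ := hg i hi
    exact ⟨l, hl⟩
  · intro i hi l hl
    obtain ⟨l', hl', hM'⟩ := hg i hi
    rw [hl, Option.some_inj] at hl'
    subst hl'
    exact ⟨hM', by simp [hi, hl]⟩
  · intro l i hi hiD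
    simp only [hiD, hi, if_false, not_true_eq_false]
    split_ifs
    · exact le_rfl
    · exact h1 l i hi
  · intro l i hi hiD a ha c hc hai hic
    simp only [hiD, hi, if_false, not_true_eq_false]
    rw [if_neg]
    · exact h2 i l l l a ha hi c hc hai hic
    -- A block interior to `M l` is not shared: an earlier or later member containing it would not
    -- be successive to `M l`.
    · rintro ⟨l', hne, hl'⟩
      rcases lt_or_gt_of_ne hne with h | h
      · exact absurd (hM l' l h i hl' a ha) (by omega)
      · exact absurd (hM l l' h c hc i hl') (by omega)
  · intro i
    by_cases hiD : i ∈ D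
    · obtain ⟨l, hl, hMl⟩ := hg i hiD
      simp only [hiD, if_true, hl, Option.some_inj]
      rw [Finset.sum_ite_eq, if_pos (Finset.mem_univ _)]
      exact h1 l i (by simp [hMl])
    · simp only [hiD, if_false]
      by_cases hS : ∃ l l', l < l' ∧ i ∈ M l ∧ i ∈ M l'
      · obtain ⟨l, l', hll, hl, hl'⟩ := hS
        have hne : ∀ l, i ∈ M l → ∃ a ∈ M l, a ≠ i := by
          intro l hl
          by_contra! hcon
          exact hiD ⟨l, Set.eq_singleton_iff_unique_mem.2 ⟨hl, hcon⟩⟩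
        -- A block shared by three members would exhaust the middle one and so belong to `D`; hence
        -- at most two members share it.
        have hmid : ∀ l₁ l₂ l₃, l₁ < l₂ → l₂ < l₃ → i ∈ M l₁ → i ∈ M l₂ → i ∉ M l₃ := by
          intro l₁ l₂ l₃ h12 h23 hi1 hi2 hi3
          obtain ⟨a, ha, hai⟩ := hne l₂ hi2
          exact hai (le_antisymm (hM _ _ h23 a ha i hi3) (hM _ _ h12 i hi1 a ha))
        -- Being more than `{i}`, the left member reaches below `i` and the right one above it, so
        -- `i` is interior and has two units to give.
        have hn : 2 ≤ n i := by
          obtain ⟨a, ha, hai⟩ := hne l hl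
          obtain ⟨c, hc, hci⟩ := hne l' hl'
          exact h2 i l l l' a ha hl c hc (lt_of_le_of_ne (hM l l' hll a ha i hl') hai)
            (lt_of_le_of_ne (hM l l' hll i hl c hc) hci.symm)
        refine le_trans ?_ hn
        calc _ ≤ ∑ l'' : Fin m, if l'' ∈ ({l, l'} : Finset (Fin m)) then 1 else 0 := by
              refine Finset.sum_le_sum fun l'' _ => ?_
              by_cases hi : i ∈ M l''
              · have hmem : l'' = l ∨ l'' = l' := by
                  by_contra! hcon
                  rcases lt_or_gt_of_ne hcon.1 with h | h
                  · exact hmid _ _ _ h hll hi hl hl'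
                  · rcases lt_or_gt_of_ne hcon.2 with h' | h'
                    · exact hmid _ _ _ h h' hl hi hl'
                    · exact hmid _ _ _ hll h' hl hl' hi
                have hex : ∃ l₀, l₀ ≠ l'' ∧ i ∈ M l₀ := by
                  rcases hmem with rfl | rfl
                  · exact ⟨l', hll.ne', hl'⟩
                  · exact ⟨l, hll.ne, hl⟩
                simp [hi, hex, hmem]
              · simp [hi]
          _ ≤ 2 := by
              rw [Finset.sum_ite_mem, Finset.univ_inter, Finset.sum_const, smul_eq_mul, mul_one]
              exact Finset.card_le_two
      · have huniq : ∀ l l', i ∈ M l → i ∈ M l' → l = l' := by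
          intro l l' hl hl'
          by_contra hne
          rcases lt_or_gt_of_ne hne with h | h
          · exact hS ⟨l, l', h, hl, hl'⟩
          · exact hS ⟨l', l, h, hl', hl⟩
        by_cases hex : ∃ l, i ∈ M l
        · obtain ⟨l, hl⟩ := hex
          rw [Finset.sum_eq_single l]
          · rw [if_neg (by simpa using hl), if_neg]
            rintro ⟨l', hne, hl'⟩
            exact hne (huniq _ _ hl' hl)
          · intro l' _ hne
            rw [if_pos]
            exact fun hl' => hne (huniq _ _ hl' hl)
          · simp
        · push Not at hex
          simp [hex]

/-- `x` does not vanish on the block `i` of the partition of `ω^{k}` given by `φ`. -/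
def Meets {k : ℕ} (φ : OmegaEQ k → ℕ) (x : OmegaEQ k →₀ ℝ) (i : ℕ) : Prop :=
  ∃ v, x v ≠ 0 ∧ φ v = i

theorem Meets.of_proj {k : ℕ} {φ : OmegaEQ k → ℕ} {x : OmegaEQ k →₀ ℝ} {i : ℕ}
    {A : Set (OmegaEQ k)} (h : Meets φ (proj A x) i) : Meets φ x i := by
  obtain ⟨v, hv, rfl⟩ := h
  exact ⟨v, (proj_apply_ne_zero.1 hv).2, rfl⟩

/-- Hölder's inequality for at most `d` terms. In the intended case `hdp` is an equality, so passing
to admissible sets loses no constant. -/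
theorem mul_sum_le_rpow {θ p : ℝ} (hθ : 0 < θ) (hp : 1 < p) {d m : ℕ} (hm : m ≤ d)
    (hdp : θ ^ p * (d : ℝ) ^ (p - 1) ≤ 1) (z : Fin m → ℝ) (hz : ∀ l, 0 ≤ z l) :
    θ * ∑ l, z l ≤ (∑ l, z l ^ p) ^ (1 / p) := by
  have hp0 : 0 < p := by linarith
  have hs : 0 ≤ ∑ l, z l := Finset.sum_nonneg fun l _ => hz l
  have hsp : 0 ≤ ∑ l, z l ^ p := Finset.sum_nonneg fun l _ => Real.rpow_nonneg (hz l) p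
  have hθp : 0 ≤ θ ^ p := Real.rpow_nonneg hθ.le p
  rw [one_div, Real.le_rpow_inv_iff_of_pos (mul_nonneg hθ.le hs) hsp hp0, Real.mul_rpow hθ.le hs]
  calc θ ^ p * (∑ l, z l) ^ p ≤ θ ^ p * ((d : ℝ) ^ (p - 1) * ∑ l, z l ^ p) := by
        refine mul_le_mul_of_nonneg_left ?_ hθp
        refine (Real.rpow_sum_le_const_mul_sum_rpow_of_nonneg Finset.univ hp.le
          fun l _ => hz l).trans (mul_le_mul_of_nonneg_right ?_ hsp)
        refine Real.rpow_le_rpow (Nat.cast_nonneg _) ?_ (by linarith)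
        simpa using hm
    _ = (θ ^ p * (d : ℝ) ^ (p - 1)) * ∑ l, z l ^ p := by ring
    _ ≤ ∑ l, z l ^ p := mul_le_of_le_one_left hsp hdp

/-- The multiplicities `n` make the induction on `j` close with the constant `θ⁻¹` unchanged. A
block that is first or last in `x` needs one unit, an interior block two: if two successive sets
share an interior block that neither fills, it becomes an end block for each and one unit apiece
suffices. A block that is all some set meets is not split; its pieces are summed first, using the
norming equation for that block alone, which is where the factor `θ⁻¹` comes from. -/
theorem normSeq_le_of_blocks {k d : ℕ} {θ : ℝ} (hθ : θ ∈ Set.Ioo (0 : ℝ) 1) {p : ℝ} (hp : 1 < p)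
    (hdp : θ ^ p * (d : ℝ) ^ (p - 1) ≤ 1) {φ : OmegaEQ k → ℕ}
    (hφ : ∀ v w : OmegaEQ k, Prec v.1 w.1 → φ v ≤ φ w) {b : ℕ → ℝ} (hb : ∀ i, 0 ≤ b i)
    (F : Finset ℕ) (j : ℕ) (x : OmegaEQ k →₀ ℝ) (n : ℕ → ℕ)
    (hxb : ∀ i, tkNorm k d θ (proj (φ ⁻¹' {i}) x) ≤ b i)
    (h1 : ∀ i, Meets φ x i → i ∈ F ∧ 1 ≤ n i)
    (h2 : ∀ i a c, Meets φ x a → Meets φ x i → Meets φ x c → a < i → i < c → 2 ≤ n i) :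
    normSeq k d θ j x ≤ θ⁻¹ * (∑ i ∈ F, n i * b i ^ p) ^ (1 / p) := by
  classical
  have hp0 : 0 < p := by linarith
  have hbp : ∀ i, 0 ≤ b i ^ p := fun i => Real.rpow_nonneg (hb i) p
  have hnb : ∀ (n : ℕ → ℕ) i, 0 ≤ n i * b i ^ p := fun n i => mul_nonneg (Nat.cast_nonneg _) (hbp i)
  have hθi : 1 ≤ θ⁻¹ := (one_le_inv₀ hθ.1).2 hθ.2.le
  have hsingle : ∀ (n : ℕ → ℕ) i, i ∈ F → 1 ≤ n i →
      b i ≤ (∑ i ∈ F, n i * b i ^ p) ^ (1 / p) := by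
    intro n i hi hn
    calc b i = (b i ^ p) ^ (1 / p) := by
          rw [← Real.rpow_mul (hb i), mul_one_div_cancel hp0.ne', Real.rpow_one]
      _ ≤ _ := by
          refine Real.rpow_le_rpow (hbp i) ?_ (by positivity)
          refine le_trans ?_ (Finset.single_le_sum (f := fun i => n i * b i ^ p)
            (fun i _ => hnb n i) hi)
          exact le_mul_of_one_le_left (hbp i) (by exact_mod_cast hn)
  have hR : ∀ n : ℕ → ℕ, 0 ≤ (∑ i ∈ F, n i * b i ^ p) ^ (1 / p) := fun n =>
    Real.rpow_nonneg (Finset.sum_nonneg fun i _ => hnb n i) _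
  induction j generalizing x n with
  | zero =>
    refine ciSup_le fun v => ?_
    by_cases hv : x v = 0
    · rw [hv, abs_zero]
      exact mul_nonneg (by linarith) (hR n)
    · obtain ⟨hF, hn⟩ := h1 (φ v) ⟨v, hv, rfl⟩
      have hle : |x v| ≤ b (φ v) := by
        refine le_trans ?_ (hxb (φ v))
        have := abs_le_tkNorm k d hθ (proj (φ ⁻¹' {φ v}) x) v
        rwa [proj_apply, if_pos (by simp)] at this
      exact (hle.trans (hsingle n _ hF hn)).trans (le_mul_of_one_le_left (hR n) hθi)
  | succ j ih =>
    refine normSeq_succ_le hθ (ih x n hxb h1 h2) fun m E hE => ?_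
    set M : Fin m → Set ℕ := fun l => {i | Meets φ (restrict (E l) x) i} with hMdef
    have hMx : ∀ l, ∀ i ∈ M l, Meets φ x i := by
      intro l i hi
      rw [hMdef, Set.mem_ofPred_eq, restrict_eq_proj] at hi
      exact hi.of_proj
    obtain ⟨D, g, N, hg, hgM, hN1, hN2, hNs⟩ := exists_distribution M (by
        rintro l l' hl i ⟨v, hv, rfl⟩ i' ⟨w, hw, rfl⟩
        rw [restrict_eq_proj, proj_apply_ne_zero] at hv hw
        exact hφ v w (hE.2.2.2 l l' hl v hv.1 w hw.1)) n
      (fun l i hi => (h1 i (hMx l i hi)).2)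
      (fun i l₁ l₂ l₃ a ha hi c hc => h2 i a c (hMx _ _ ha) (hMx _ _ hi) (hMx _ _ hc))
    set y : Fin m → OmegaEQ k →₀ ℝ := fun l => proj {v | φ v ∉ D} (restrict (E l) x) with hy
    -- `y l` is the part of `E l` away from the blocks of `D`. The total cost `θ⁻¹ * b i` of a block
    -- of `D` is attributed to the index `g i`, for which `y` vanishes, so the two summands never
    -- compete.
    set z : Fin m → ℝ := fun l => normSeq k d θ j (y l) +
      ∑ i ∈ F with i ∈ D ∧ g i = some l, θ⁻¹ * b i with hz
    have hz0 : ∀ l, 0 ≤ z l := fun l => add_nonneg ((normSeq_props k d hθ j).1 _)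
      (Finset.sum_nonneg fun i _ => mul_nonneg (by linarith) (hb i))
    have hyM : ∀ l i, Meets φ (y l) i → i ∈ M l ∧ i ∉ D := by
      rintro l i ⟨v, hv, rfl⟩
      obtain ⟨hv1, hv2⟩ := proj_apply_ne_zero.1 hv
      exact ⟨⟨v, hv2, rfl⟩, hv1⟩
    have hzle : ∀ l, z l ≤ θ⁻¹ * (∑ i ∈ F, N l i * b i ^ p) ^ (1 / p) := by
      intro l
      by_cases hl : ∃ i ∈ D, g i = some l
      · obtain ⟨i, hiD, hgi⟩ := hl
        obtain ⟨hMi, hNi⟩ := hgM i hiD l hgi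
        have hiF : i ∈ F := (h1 i (hMx l i (by rw [hMi]; rfl))).1
        have hF : (F.filter fun i => i ∈ D ∧ g i = some l) = {i} := by
          ext i'
          simp only [Finset.mem_filter, Finset.mem_singleton]
          constructor
          · rintro ⟨-, h, h'⟩
            have := (hgM i' h l h').1
            rw [hMi, Set.singleton_eq_singleton_iff] at this
            exact this.symm
          · rintro rfl
            exact ⟨hiF, hiD, hgi⟩
        have hy0 : y l = 0 := by
          ext v
          by_contra hv
          obtain ⟨h, h'⟩ := hyM l (φ v) ⟨v, hv, rfl⟩
          rw [hMi, Set.mem_singleton_iff] at h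
          exact h' (h ▸ hiD)
        rw [hz]
        simp only [hF, hy0, normSeq_zero hθ, Finset.sum_singleton, zero_add]
        exact mul_le_mul_of_nonneg_left (hsingle _ i hiF hNi) (by linarith)
      · push Not at hl
        have hF : (F.filter fun i => i ∈ D ∧ g i = some l) = ∅ :=
          Finset.filter_eq_empty_iff.2 fun i _ h => hl i h.1 h.2
        rw [hz]
        simp only [hF, Finset.sum_empty, add_zero]
        refine ih (y l) (N l) (fun i => ?_) (fun i hi => ?_) fun i a c ha hi hc hai hic => ?_
        · refine le_trans ?_ (hxb i)
          rw [hy]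
          simp only [restrict_eq_proj, proj_proj]
          rw [← Set.inter_comm, ← proj_proj]
          exact tkNorm_proj_le hθ _ _
        · obtain ⟨hi1, hi2⟩ := hyM l i hi
          exact ⟨(h1 i (hMx l i hi1)).1, hN1 l i hi1 hi2⟩
        · obtain ⟨hi1, hi2⟩ := hyM l i hi
          exact hN2 l i hi1 hi2 a (hyM l a ha).1 c (hyM l c hc).1 hai hic
    have hdec : ∀ l, restrict (E l) x =
        y l + ∑ i ∈ F with i ∈ D, restrict (E l) (proj (φ ⁻¹' {i}) x) := by
      intro l
      ext v
      rw [Finsupp.add_apply, Finsupp.finsetSum_apply]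
      simp only [hy, restrict_eq_proj]
      by_cases hv : proj (E l : Set (OmegaEQ k)) x v = 0
      · rw [hv, proj_apply, hv, ite_self, zero_add]
        refine (Finset.sum_eq_zero fun i _ => ?_).symm
        by_contra h0
        rw [proj_proj, Set.inter_comm, ← proj_proj] at h0
        exact (proj_apply_ne_zero.1 h0).2 hv
      · have hx := (proj_apply_ne_zero.1 hv)
        have hF := (h1 (φ v) ⟨v, hx.2, rfl⟩).1
        by_cases hD : φ v ∈ D
        · rw [proj_apply {v | φ v ∉ D}, if_neg (by simpa using hD), zero_add, Finset.sum_eq_single (φ v)]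
          · simp [proj_apply]
          · intro i _ hi
            simp [proj_apply, Ne.symm hi]
          · intro h
            exact absurd (Finset.mem_filter.2 ⟨hF, hD⟩) h
        · rw [proj_apply {v | φ v ∉ D}, if_pos (by simpa using hD), Finset.sum_eq_zero, add_zero]
          intro i hi
          have : φ v ≠ i := fun h => hD (h ▸ (Finset.mem_filter.1 hi).2)
          simp [proj_apply, this]
    have hfib : ∑ l, ∑ i ∈ F with i ∈ D ∧ g i = some l, θ⁻¹ * b i =
        ∑ i ∈ F with i ∈ D, θ⁻¹ * b i := by
      simp only [Finset.sum_filter]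
      rw [Finset.sum_comm]
      refine Finset.sum_congr rfl fun i _ => ?_
      by_cases hi : i ∈ D
      · obtain ⟨l, hl⟩ := hg i hi
        simp [hi, hl]
      · simp [hi]
    calc θ * ∑ l, normSeq k d θ j (restrict (E l) x)
        ≤ θ * ∑ l, (normSeq k d θ j (y l) +
            ∑ i ∈ F with i ∈ D, normSeq k d θ j (restrict (E l) (proj (φ ⁻¹' {i}) x))) := by
          refine mul_le_mul_of_nonneg_left (Finset.sum_le_sum fun l _ => ?_) hθ.1.le
          rw [hdec l]
          refine ((normSeq_props k d hθ j).2.2.2 _ _).trans ?_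
          gcongr
          exact normSeq_sum_le hθ j _ _
      _ = θ * ∑ l, normSeq k d θ j (y l) + ∑ i ∈ F with i ∈ D,
            θ * ∑ l, normSeq k d θ j (restrict (E l) (proj (φ ⁻¹' {i}) x)) := by
          rw [Finset.sum_add_distrib, mul_add, Finset.sum_comm, Finset.mul_sum (s := F.filter _)]
      -- Cutting a single block by all the sets `E l` costs at most the norm of that block.
      _ ≤ θ * ∑ l, normSeq k d θ j (y l) + ∑ i ∈ F with i ∈ D, b i := by
          gcongr with i _
          exact ((sum_normSeq_restrict_le hθ j _ hE).trans (normSeq_le_tkNorm hθ _ _)).trans (hxb i)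
      _ = θ * ∑ l, z l := by
          rw [hz, Finset.sum_add_distrib, hfib, mul_add, ← Finset.mul_sum (a := θ⁻¹), ← mul_assoc,
            mul_inv_cancel₀ hθ.1.ne', one_mul]
      _ ≤ (∑ l, z l ^ p) ^ (1 / p) := mul_sum_le_rpow hθ.1 hp hE.2.1 hdp z hz0
      _ ≤ (∑ l, (θ⁻¹) ^ p * ∑ i ∈ F, N l i * b i ^ p) ^ (1 / p) := by
          refine Real.rpow_le_rpow (Finset.sum_nonneg fun l _ => Real.rpow_nonneg (hz0 l) p)
            (Finset.sum_le_sum fun l _ => ?_) (by positivity)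
          refine (Real.rpow_le_rpow (hz0 l) (hzle l) hp0.le).trans_eq ?_
          rw [Real.mul_rpow (by linarith) (hR _), ← Real.rpow_mul
            (Finset.sum_nonneg fun i _ => hnb _ i), one_div_mul_cancel hp0.ne', Real.rpow_one]
      _ ≤ ((θ⁻¹) ^ p * ∑ i ∈ F, n i * b i ^ p) ^ (1 / p) := by
          refine Real.rpow_le_rpow (Finset.sum_nonneg fun l _ => mul_nonneg
            (Real.rpow_nonneg (by linarith) _) (Finset.sum_nonneg fun i _ => hnb _ i)) ?_
            (by positivity)
          rw [← Finset.mul_sum, Finset.sum_comm]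
          refine mul_le_mul_of_nonneg_left (Finset.sum_le_sum fun i _ => ?_)
            (Real.rpow_nonneg (by linarith) _)
          rw [← Finset.sum_mul]
          exact mul_le_mul_of_nonneg_right (by exact_mod_cast hNs i) (hbp i)
      _ = θ⁻¹ * (∑ i ∈ F, n i * b i ^ p) ^ (1 / p) := by
          rw [Real.mul_rpow (Real.rpow_nonneg (by linarith) _)
            (Finset.sum_nonneg fun i _ => hnb _ i), ← Real.rpow_mul (by linarith),
            mul_one_div_cancel hp0.ne', Real.rpow_one]

/-- The upper `ℓ_p`-estimate for block sequences. -/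
theorem tkNorm_le_of_blocks {k d : ℕ} {θ : ℝ} (hθ : θ ∈ Set.Ioo (0 : ℝ) 1) {p : ℝ} (hp : 1 < p)
    (hdp : θ ^ p * (d : ℝ) ^ (p - 1) ≤ 1) {φ : OmegaEQ k → ℕ}
    (hφ : ∀ v w : OmegaEQ k, Prec v.1 w.1 → φ v ≤ φ w) {b : ℕ → ℝ} (hb : ∀ i, 0 ≤ b i)
    (F : Finset ℕ) (x : OmegaEQ k →₀ ℝ) (hxF : ∀ v, x v ≠ 0 → φ v ∈ F)
    (hxb : ∀ i, tkNorm k d θ (proj (φ ⁻¹' {i}) x) ≤ b i) :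
    tkNorm k d θ x ≤ θ⁻¹ * 2 * (∑ i ∈ F, b i ^ p) ^ (1 / p) := by
  have hbp : ∀ i, 0 ≤ b i ^ p := fun i => Real.rpow_nonneg (hb i) p
  have hS : 0 ≤ ∑ i ∈ F, b i ^ p := Finset.sum_nonneg fun i _ => hbp i
  refine ciSup_le fun j => ?_
  -- Constant multiplicity 2 meets every requirement and costs the factor `2 ^ (1 / p) ≤ 2`.
  refine (normSeq_le_of_blocks hθ hp hdp hφ hb F j x (fun _ => 2) hxb ?_ ?_).trans ?_
  · rintro i ⟨v, hv, rfl⟩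
    exact ⟨hxF v hv, by norm_num⟩
  · intros; rfl
  · rw [← Finset.mul_sum, Real.mul_rpow (by norm_num) hS, mul_assoc]
    refine mul_le_mul_of_nonneg_left (mul_le_mul_of_nonneg_right ?_ (Real.rpow_nonneg hS _))
      (inv_nonneg.2 hθ.1.le)
    calc ((2 : ℕ) : ℝ) ^ (1 / p) ≤ (2 : ℝ) ^ (1 : ℝ) := by
          push_cast
          exact Real.rpow_le_rpow_of_exponent_le (by norm_num)
            ((div_le_one (by linarith)).2 hp.le)
      _ = 2 := Real.rpow_one 2

/-! ### The lower estimate -/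

/-- If the functionals `θ ^ g i` are produced by repeatedly splitting the unit interval into `d`
equal parts, where `Q` gives positions in the unit interval which are sufficiently separated, then
they are bounded by every set function `ν` that satisfies the lower estimate for successive sets. -/
theorem sum_pow_le_of_split {d : ℕ} {θ : ℝ} (hd : 0 < d) (ν : Finset ℕ → ℝ) (c : ℕ → ℝ)
    (hν : ∀ I, 0 ≤ ν I) (hsing : ∀ I, ∀ i ∈ I, c i ≤ ν I) (hθ : 0 < θ)
    (hsplit : ∀ (I : Finset ℕ) (h : Fin d → Finset ℕ), (∀ l, h l ⊆ I) →
      (∀ l l', l < l' → ∀ i ∈ h l, ∀ i' ∈ h l', i < i') → θ * ∑ l, ν (h l) ≤ ν I)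
    (F : Finset ℕ) (Q : ℕ → ℝ) (g : ℕ → ℕ) (hQ0 : ∀ i ∈ F, 0 ≤ Q i)
    (hQ : ∀ i ∈ F, ∀ i' ∈ F, i < i' → Q i < Q i')
    (hQg : ∀ i ∈ F, ∀ i' ∈ F, i ≠ i' → ((d : ℝ)⁻¹) ^ g i < |Q i - Q i'|)
    (t h m : ℕ) (ht : ∀ i ∈ F, g i ≤ h + t) :
    ∑ i ∈ F with ⌊(d : ℝ) ^ h * Q i⌋₊ = m, θ ^ (g i - h) * c i ≤
      ν (F.filter fun i => ⌊(d : ℝ) ^ h * Q i⌋₊ = m) := by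
  have hd0 : (0 : ℝ) < d := by exact_mod_cast hd
  have hd1 : (1 : ℝ) ≤ d := by exact_mod_cast hd
  -- A cell of level `h` has length `d⁻¹ ^ h`. If it contains `i` with `g i ≤ h`, the separation of
  -- `Q` leaves no room for a second point, and the exponent `g i - h` is 0.
  have hone : ∀ h m, (∃ i ∈ F, ⌊(d : ℝ) ^ h * Q i⌋₊ = m ∧ g i ≤ h) →
      ∑ i ∈ F with ⌊(d : ℝ) ^ h * Q i⌋₊ = m, θ ^ (g i - h) * c i ≤
        ν (F.filter fun i => ⌊(d : ℝ) ^ h * Q i⌋₊ = m) := by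
    rintro h m ⟨i, hi, rfl, hgi⟩
    rw [Finset.sum_eq_single i]
    · rw [Nat.sub_eq_zero_of_le hgi, pow_zero, one_mul]
      exact hsing _ i (Finset.mem_filter.2 ⟨hi, rfl⟩)
    · intro i' hi' hne
      exfalso
      rw [Finset.mem_filter] at hi'
      have h1 := hQg i hi i' hi'.1 hne.symm
      have h2 : |(d : ℝ) ^ h * Q i - (d : ℝ) ^ h * Q i'| < 1 := by
        have ha : 0 ≤ (d : ℝ) ^ h * Q i := mul_nonneg (by positivity) (hQ0 i hi)
        have hb : 0 ≤ (d : ℝ) ^ h * Q i' := mul_nonneg (by positivity) (hQ0 i' hi'.1)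
        have ha1 := Nat.floor_le ha
        have hb1 := Nat.floor_le hb
        have ha2 := Nat.lt_floor_add_one ((d : ℝ) ^ h * Q i)
        have hb2 := Nat.lt_floor_add_one ((d : ℝ) ^ h * Q i')
        rw [hi'.2] at hb1 hb2
        rw [abs_lt]
        constructor <;> linarith
      rw [← mul_sub, abs_mul, abs_of_pos (by positivity)] at h2
      have h3 : ((d : ℝ)⁻¹) ^ h ≤ ((d : ℝ)⁻¹) ^ g i :=
        pow_le_pow_of_le_one (by positivity) (inv_le_one_of_one_le₀ hd1) hgi
      have h4 : (d : ℝ) ^ h * ((d : ℝ)⁻¹) ^ h = 1 := by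
        rw [← mul_pow, mul_inv_cancel₀ hd0.ne', one_pow]
      have h5 := mul_lt_mul_of_pos_left (h3.trans_lt h1) (pow_pos hd0 h)
      linarith
    · exact fun hn => absurd hn (by simp [hi])
  -- `t` bounds the number of levels still needed below level `h`. A cell in which no point is yet
  -- isolated is split into its `d` subcells, each split contributing one factor `θ`.
  induction t generalizing h m with
  | zero =>
    by_cases hex : ∃ i ∈ F, ⌊(d : ℝ) ^ h * Q i⌋₊ = m
    · obtain ⟨i, hi, him⟩ := hex
      exact hone h m ⟨i, hi, him, ht i hi⟩
    · push Not at hex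
      rw [Finset.filter_eq_empty_iff.2 fun i hi => hex i hi, Finset.sum_empty]
      exact hν _
  | succ t ih =>
    by_cases hex : ∃ i ∈ F, ⌊(d : ℝ) ^ h * Q i⌋₊ = m ∧ g i ≤ h
    · exact hone h m hex
    push Not at hex
    set I := F.filter fun i => ⌊(d : ℝ) ^ h * Q i⌋₊ = m with hI
    have hstep : ∀ i, ⌊(d : ℝ) ^ (h + 1) * Q i⌋₊ / d = ⌊(d : ℝ) ^ h * Q i⌋₊ := by
      intro i
      rw [← Nat.floor_div_natCast]
      congr 1
      field_simp
      ring
    have hchild : ∀ l : Fin d, (I.filter fun i =>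
        (⟨⌊(d : ℝ) ^ (h + 1) * Q i⌋₊ % d, Nat.mod_lt _ hd⟩ : Fin d) = l) =
        F.filter fun i => ⌊(d : ℝ) ^ (h + 1) * Q i⌋₊ = d * m + l := by
      intro l
      ext i
      simp only [hI, Finset.mem_filter, Fin.ext_iff, ← hstep i, and_assoc]
      refine and_congr_right fun _ => ?_
      constructor
      · rintro ⟨h1, h2⟩
        rw [← h1, ← h2]
        exact (Nat.div_add_mod _ _).symm
      · intro h1
        rw [h1]
        constructor
        · rw [Nat.mul_add_div hd, Nat.div_eq_of_lt l.2, add_zero]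
        · rw [Nat.mul_add_mod, Nat.mod_eq_of_lt l.2]
    calc ∑ i ∈ I, θ ^ (g i - h) * c i
        = θ * ∑ i ∈ I, θ ^ (g i - (h + 1)) * c i := by
          rw [Finset.mul_sum]
          refine Finset.sum_congr rfl fun i hi => ?_
          rw [hI, Finset.mem_filter] at hi
          have := hex i hi.1 hi.2
          rw [show g i - h = g i - (h + 1) + 1 by omega, pow_succ]
          ring
      _ = θ * ∑ l : Fin d, ∑ i ∈ F with ⌊(d : ℝ) ^ (h + 1) * Q i⌋₊ = d * m + l,
            θ ^ (g i - (h + 1)) * c i := by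
          rw [← Finset.sum_fiberwise I fun i =>
            (⟨⌊(d : ℝ) ^ (h + 1) * Q i⌋₊ % d, Nat.mod_lt _ hd⟩ : Fin d)]
          simp only [hchild]
      _ ≤ θ * ∑ l : Fin d, ν (F.filter fun i => ⌊(d : ℝ) ^ (h + 1) * Q i⌋₊ = d * m + l) := by
          refine mul_le_mul_of_nonneg_left (Finset.sum_le_sum fun l _ => ?_) hθ.le
          exact ih (h + 1) _ fun i hi => by have := ht i hi; omega
      _ ≤ ν I := by
          refine hsplit I _ (fun l => ?_) fun l l' hl i hi i' hi' => ?_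
          · rw [← hchild l]
            exact Finset.filter_subset _ _
          · rw [Finset.mem_filter] at hi hi'
            by_contra hcon
            rcases (not_lt.1 hcon).eq_or_lt with heq | hlt
            · subst heq
              have := hi.2.symm.trans hi'.2
              have hl' : (l : ℕ) < l' := hl
              omega
            · have h1 := hQ i' hi'.1 i hi.1 hlt
              have h2 : ⌊(d : ℝ) ^ (h + 1) * Q i'⌋₊ ≤ ⌊(d : ℝ) ^ (h + 1) * Q i⌋₊ := by
                gcongr
              have hl' : (l : ℕ) < l' := hl
              omega

/-- A set function which satisfies the lower estimate for successive sets dominates a multiple of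
the `ℓ_p`-norm. -/
theorem rpow_sum_le_of_split {d : ℕ} {θ p : ℝ} (hd : 2 ≤ d) (hp : 1 < p)
    (hθ : θ = ((d : ℝ)⁻¹) ^ (1 - 1 / p)) (ν : Finset ℕ → ℝ) (c : ℕ → ℝ)
    (hν : ∀ I, 0 ≤ ν I) (hmono : ∀ I I', I ⊆ I' → ν I ≤ ν I') (hc : ∀ i, 0 ≤ c i)
    (hsing : ∀ I, ∀ i ∈ I, c i ≤ ν I)
    (hsplit : ∀ (I : Finset ℕ) (h : Fin d → Finset ℕ), (∀ l, h l ⊆ I) →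
      (∀ l l', l < l' → ∀ i ∈ h l, ∀ i' ∈ h l', i < i') → θ * ∑ l, ν (h l) ≤ ν I)
    (F : Finset ℕ) :
    ((2 * d : ℝ)⁻¹) ^ (1 - 1 / p) * (∑ i ∈ F, c i ^ p) ^ (1 / p) ≤ ν F := by
  have hp0 : 0 < p := by linarith
  have hd0 : (0 : ℝ) < d := by exact_mod_cast (by omega : 0 < d)
  have hd1 : (1 : ℝ) < d := by exact_mod_cast (by omega : 1 < d)
  have he : 0 ≤ 1 - 1 / p := by
    rw [sub_nonneg, div_le_one hp0]; exact hp.le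
  have hθ0 : 0 < θ := hθ ▸ Real.rpow_pos_of_pos (inv_pos.2 hd0) _
  -- Zero coefficients would yield intervals of length 0, whose positions are not separated.
  wlog hpos : ∀ i ∈ F, 0 < c i generalizing F with H
  · refine le_trans (le_of_eq ?_) ((H (F.filter fun i => 0 < c i) ?_).trans
      (hmono _ _ (Finset.filter_subset _ _)))
    · congr 2
      refine (Finset.sum_filter_of_ne fun i _ hi => ?_).symm
      refine lt_of_le_of_ne (hc i) fun h0 => hi ?_
      rw [← h0, Real.zero_rpow hp0.ne']
    · exact fun i hi => (Finset.mem_filter.1 hi).2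
  set S := ∑ i ∈ F, c i ^ p with hS
  rcases F.eq_empty_or_nonempty with hF | hF
  · have : S = 0 := by rw [hS, hF, Finset.sum_empty]
    rw [this, Real.zero_rpow (by positivity), mul_zero]
    exact hν _
  have hS0 : 0 < S := Finset.sum_pos (fun i hi => Real.rpow_pos_of_pos (hpos i hi) p) hF
  set q : ℕ → ℝ := fun i => c i ^ p / S with hq
  have hq0 : ∀ i, 0 ≤ q i := fun i => div_nonneg (Real.rpow_nonneg (hc i) p) hS0.le
  have hqpos : ∀ i ∈ F, 0 < q i := fun i hi => div_pos (Real.rpow_pos_of_pos (hpos i hi) p) hS0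
  have hqsum : ∑ i ∈ F, q i = 1 := by
    rw [hq, ← Finset.sum_div, ← hS, div_self hS0.ne']
  have hq1 : ∀ i ∈ F, q i ≤ 1 := fun i hi =>
    hqsum ▸ Finset.single_le_sum (fun i _ => hq0 i) hi
  -- The midpoints of consecutive intervals of lengths `q i` that fill the unit interval; two of
  -- them differ by at least the sum of their half-lengths.
  set Q : ℕ → ℝ := fun i => ∑ i' ∈ F with i' < i, q i' + q i / 2 with hQ
  have hQ0 : ∀ i, 0 ≤ Q i := fun i =>
    add_nonneg (Finset.sum_nonneg fun i _ => hq0 i) (by linarith [hq0 i])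
  have hQlt : ∀ i ∈ F, ∀ i' ∈ F, i < i' → q i / 2 + q i' / 2 ≤ Q i' - Q i := by
    intro i hi i' hi' hlt
    have : ∑ j ∈ F with j < i, q j + q i ≤ ∑ j ∈ F with j < i', q j := by
      rw [add_comm, ← Finset.sum_insert (by simp)]
      refine Finset.sum_le_sum_of_subset_of_nonneg ?_ fun j _ _ => hq0 j
      intro j hj
      rw [Finset.mem_insert, Finset.mem_filter] at hj
      rw [Finset.mem_filter]
      rcases hj with rfl | ⟨h1, h2⟩
      · exact ⟨hi, hlt⟩
      · exact ⟨h1, h2.trans hlt⟩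
    simp only [hQ]
    linarith
  have hQ1 : ∀ i ∈ F, Q i < 1 := by
    intro i hi
    have : ∑ j ∈ F with j < i, q j + q i ≤ 1 := by
      rw [← hqsum, add_comm, ← Finset.sum_insert (by simp)]
      refine Finset.sum_le_sum_of_subset_of_nonneg ?_ fun j _ _ => hq0 j
      intro j hj
      rw [Finset.mem_insert, Finset.mem_filter] at hj
      rcases hj with rfl | ⟨h1, _⟩
      · exact hi
      · exact h1
    have := hqpos i hi
    simp only [hQ]
    linarith
  -- Half the length of the `i`-th interval, rounded to a power of `d⁻¹`; point `i` is isolated at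
  -- depth `g i + 1`.
  have hgex : ∀ i, ∃ n : ℕ, i ∈ F → ((d : ℝ)⁻¹) ^ (n + 1) < q i / 2 ∧ q i / 2 ≤ ((d : ℝ)⁻¹) ^ n := by
    intro i
    by_cases hi : i ∈ F
    · obtain ⟨n, hn⟩ := exists_nat_pow_near_of_lt_one (half_pos (hqpos i hi))
        (by linarith [hq1 i hi]) (inv_pos.2 hd0) (inv_lt_one_of_one_lt₀ hd1)
      exact ⟨n, fun _ => hn⟩
    · exact ⟨0, fun h => absurd h hi⟩
  choose g hg using hgex
  have key := sum_pow_le_of_split (by omega) ν c hν hsing hθ0 hsplit F Q (fun i => g i + 1)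
    (fun i _ => hQ0 i)
    (fun i hi i' hi' hlt => by linarith [hQlt i hi i' hi' hlt, hqpos i hi, hqpos i' hi'])
    (fun i hi i' hi' hne => by
      have h1 := (hg i hi).1
      have h2 := hqpos i' hi'
      rcases lt_or_gt_of_ne hne with hlt | hlt
      · have := hQlt i hi i' hi' hlt
        rw [abs_sub_comm]
        exact lt_of_lt_of_le (by linarith) (le_abs_self _)
      · have := hQlt i' hi' i hi hlt
        exact lt_of_lt_of_le (by linarith) (le_abs_self _))
    -- A crude common bound for the depths. The root cell, level 0 and index 0, contains all of `F`
    -- because `Q < 1`.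
    (∑ i ∈ F, (g i + 1)) 0 0
    (fun i hi => by
      rw [zero_add]
      exact Finset.single_le_sum (f := fun i => g i + 1) (fun _ _ => Nat.zero_le _) hi)
  rw [Finset.filter_true_of_mem fun i hi => by
    rw [pow_zero, one_mul, Nat.floor_eq_zero]; exact hQ1 i hi] at key
  refine le_trans ?_ key
  calc ((2 * d : ℝ)⁻¹) ^ (1 - 1 / p) * S ^ (1 / p)
      = ∑ i ∈ F, ((2 * d : ℝ)⁻¹) ^ (1 - 1 / p) * S ^ (1 / p) * q i := by
        rw [← Finset.mul_sum, hqsum, mul_one]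
    _ ≤ _ := by
        refine Finset.sum_le_sum fun i hi => ?_
        have hci : c i = S ^ (1 / p) * q i ^ (1 / p) := by
          rw [← Real.mul_rpow hS0.le (hq0 i), hq, mul_div_cancel₀ _ hS0.ne',
            ← Real.rpow_mul (hc i), mul_one_div_cancel hp0.ne', Real.rpow_one]
        -- In the constant, 2 comes from the half-length and `d` from rounding to a power of `d⁻¹`.
        have hθi : ((2 * d : ℝ)⁻¹) ^ (1 - 1 / p) * q i ^ (1 - 1 / p) ≤ θ ^ (g i + 1 - 0) := by
          rw [← Real.mul_rpow (by positivity) (hq0 i), hθ, Nat.sub_zero, ← Real.rpow_natCast,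
            ← Real.rpow_mul (by positivity), mul_comm (1 - 1 / p), Real.rpow_mul (by positivity),
            Real.rpow_natCast]
          refine Real.rpow_le_rpow (mul_nonneg (by positivity) (hq0 i)) ?_ he
          rw [pow_succ, mul_inv]
          calc (2 : ℝ)⁻¹ * (d : ℝ)⁻¹ * q i = q i / 2 * (d : ℝ)⁻¹ := by ring
            _ ≤ _ := mul_le_mul_of_nonneg_right (hg i hi).2 (by positivity)
        calc ((2 * d : ℝ)⁻¹) ^ (1 - 1 / p) * S ^ (1 / p) * q i
            = (((2 * d : ℝ)⁻¹) ^ (1 - 1 / p) * q i ^ (1 - 1 / p)) * c i := by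
              have : q i = q i ^ (1 - 1 / p) * q i ^ (1 / p) := by
                rw [← Real.rpow_add (hqpos i hi), sub_add_cancel, Real.rpow_one]
              rw [hci]
              nth_rewrite 1 [this]
              ring
          _ ≤ _ := mul_le_mul_of_nonneg_right hθi (hc i)

/-! ### Trees of tails -/

/-- The value at position `i` of the image of a sequence with `i`-th entry `a` under the tree with
stem `s` whose other entries are at least `N`. -/
def shiftEntry (s : List ℕ) (N i a : ℕ) : ℕ :=
  if i < s.length ∧ a = 0 then s.getD i 0 else N + a

theorem shiftEntry_of_pos {s : List ℕ} {N i a : ℕ} (ha : 0 < a) : shiftEntry s N i a = N + a :=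
  if_neg fun h => ha.ne' h.2

theorem shiftEntry_of_length_le {s : List ℕ} {N i a : ℕ} (hi : s.length ≤ i) :
    shiftEntry s N i a = N + a :=
  if_neg fun h => absurd h.1 (not_lt.2 hi)

theorem shiftEntry_le {s : List ℕ} {N : ℕ} (hN : ∀ a ∈ s, a ≤ N) (i a : ℕ) :
    shiftEntry s N i a ≤ N + a := by
  unfold shiftEntry
  split_ifs with h
  · rw [List.getD_eq_getElem _ _ h.1]
    exact (hN _ (List.getElem_mem h.1)).trans (Nat.le_add_right _ _)
  · exact le_rfl

theorem shiftEntry_strictMono {s : List ℕ} {N : ℕ} (hN : ∀ a ∈ s, a ≤ N) {i i' a a' : ℕ}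
    (h : a < a') : shiftEntry s N i a < shiftEntry s N i' a' := by
  rw [shiftEntry_of_pos (by omega : 0 < a')]
  exact (shiftEntry_le hN i a).trans_lt (by omega)

theorem shiftEntry_mono {s : List ℕ} (hs : s.Pairwise (· ≤ ·)) {N : ℕ} (hN : ∀ a ∈ s, a ≤ N)
    {i i' : ℕ} (h : i ≤ i') (a : ℕ) : shiftEntry s N i a ≤ shiftEntry s N i' a := by
  by_cases h' : i' < s.length ∧ a = 0
  · have hi : i < s.length := h.trans_lt h'.1
    rw [shiftEntry, shiftEntry, if_pos h', if_pos ⟨hi, h'.2⟩, List.getD_eq_getElem _ _ hi,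
      List.getD_eq_getElem _ _ h'.1]
    rcases h.eq_or_lt with rfl | hlt
    · exact le_rfl
    · exact List.pairwise_iff_getElem.1 hs i i' hi h'.1 hlt
  · rw [shiftEntry.eq_def s N i', if_neg h']
    exact shiftEntry_le hN i a

theorem shiftEntry_le_shiftEntry {s : List ℕ} (hs : s.Pairwise (· ≤ ·)) {N : ℕ}
    (hN : ∀ a ∈ s, a ≤ N) {i i' a a' : ℕ} (h : i ≤ i') (ha : a ≤ a') :
    shiftEntry s N i a ≤ shiftEntry s N i' a' := by
  rcases ha.eq_or_lt with rfl | hlt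
  · exact shiftEntry_mono hs hN h a
  · exact (shiftEntry_strictMono hN hlt).le

/-- The tree with stem `s` whose other entries are at least `N`. -/
def shiftTree {k : ℕ} (s : List ℕ) (hs : s.Pairwise (· ≤ ·)) (N : ℕ) (hN : ∀ a ∈ s, a ≤ N)
    (u : OmegaLE k) : OmegaLE k :=
  ⟨u.1.mapIdx (shiftEntry s N), by
    rw [List.pairwise_iff_getElem]
    intro i i' hi hi' hlt
    rw [List.getElem_mapIdx, List.getElem_mapIdx]
    exact shiftEntry_le_shiftEntry hs hN hlt.le (List.pairwise_iff_getElem.1 u.2.1 _ _ _ _ hlt),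
    by rw [List.length_mapIdx]; exact u.2.2⟩

/-- A zero entry within the stem keeps the stem's value, and every other entry moves to `N + a`,
beyond the stem. As `s` is non-decreasing and bounded by `N`, a larger entry, or the same entry
further right, cannot get a smaller image, which gives `≺`; the image depends on entries position by
position, which gives `⊏`. -/
theorem isTree_shiftTree {k : ℕ} (s : List ℕ) (hs : s.Pairwise (· ≤ ·)) (N : ℕ)
    (hN : ∀ a ∈ s, a ≤ N) : IsTree (shiftTree (k := k) s hs N hN) := by
  have hpre : ∀ u w : List ℕ, u <+: w → u.mapIdx (shiftEntry s N) <+: w.mapIdx (shiftEntry s N) := by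
    rintro u _ ⟨r, rfl⟩
    rw [List.mapIdx_append]
    exact List.prefix_append _ _
  constructor
  · rintro ⟨u, hu, huk⟩ ⟨w, hw, hwk⟩ h
    simp only [shiftTree] at h ⊢
    rcases h with ⟨h1, h2⟩ | ⟨h1, h2, h⟩
    · left
      simpa [List.mapIdx_eq_nil_iff] using And.intro h1 h2
    right
    refine ⟨by simpa using h1, by simpa using h2, ?_⟩
    rw [List.getLast_mapIdx, List.getLast_mapIdx]
    rcases h with h | ⟨h, hlt⟩
    · exact Or.inl (shiftEntry_strictMono hN h)
    rw [h]
    rw [List.lt_iff_exists] at hlt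
    rcases hlt with ⟨htake, hlen⟩ | ⟨i, hi, hi', heq, hlt⟩
    · have hp := hpre u w (htake ▸ List.take_prefix _ _)
      have hle : shiftEntry s N (u.length - 1) (w.getLast h2) ≤
          shiftEntry s N (w.length - 1) (w.getLast h2) :=
        shiftEntry_mono hs hN (by omega) _
      -- A common last entry 0 may turn into two different entries of `s`; then the last entries
      -- already decide the comparison.
      rcases hle.lt_or_eq with hl | he
      · exact Or.inl hl
      · refine Or.inr ⟨he, List.lt_iff_exists.2 (Or.inl ⟨?_, by simpa using hlen⟩)⟩
        exact List.prefix_iff_eq_take.1 hp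
    -- The lists differ at an entry where `w` is positive, so the common last entry is positive and
    -- its image does not depend on the position.
    · have hpos : 0 < w.getLast h2 := by
        have : w[i] ≤ w.getLast h2 := by
          rw [List.getLast_eq_getElem]
          rcases Nat.eq_or_lt_of_le (Nat.le_sub_one_of_lt hi') with hh | hh
          · simp [hh]
          · exact List.pairwise_iff_getElem.1 hw _ _ _ _ hh
        omega
      refine Or.inr ⟨?_, List.lt_iff_exists.2 (Or.inr ⟨i, by simpa using hi, by simpa using hi',
        fun j hj => ?_, ?_⟩)⟩
      · rw [shiftEntry_of_pos hpos, shiftEntry_of_pos hpos]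
      · rw [List.getElem_mapIdx, List.getElem_mapIdx, heq j hj]
      · rw [List.getElem_mapIdx, List.getElem_mapIdx]
        exact shiftEntry_strictMono hN hlt
  · rintro u w ⟨h1, h2⟩
    exact ⟨hpre _ _ h1, by simpa [shiftTree] using h2⟩

/-- The last entry of a sequence. -/
def top {k : ℕ} (v : OmegaEQ k) : ℕ := v.1.getD (k - 1) 0

theorem top_eq_getLast {k : ℕ} (v : OmegaEQ k) (h : v.1 ≠ []) : top v = v.1.getLast h := by
  have hl := List.length_pos_iff.2 h
  have := v.2.2
  rw [top, List.getLast_eq_getElem, List.getD_eq_getElem _ _ (by omega)]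
  simp only [this]

theorem prec_of_top_lt {k : ℕ} (hk : 1 ≤ k) {v w : OmegaEQ k} (h : top v < top w) :
    Prec v.1 w.1 := by
  have hv : v.1 ≠ [] := List.ne_nil_of_length_pos (by rw [v.2.2]; exact hk)
  have hw : w.1 ≠ [] := List.ne_nil_of_length_pos (by rw [w.2.2]; exact hk)
  exact Or.inr ⟨hv, hw, Or.inl (by rwa [← top_eq_getLast, ← top_eq_getLast])⟩

theorem top_le_of_prec {k : ℕ} (hk : 1 ≤ k) {v w : OmegaEQ k} (h : Prec v.1 w.1) :
    top v ≤ top w := by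
  have hv : v.1 ≠ [] := List.ne_nil_of_length_pos (by rw [v.2.2]; exact hk)
  rcases h with ⟨h, _⟩ | ⟨h1, h2, h⟩
  · exact absurd h hv
  · rw [← top_eq_getLast, ← top_eq_getLast] at h
    rcases h with h | h
    · exact h.le
    · exact h.1.le

theorem getElem_le_top {k : ℕ} (v : OmegaEQ k) {i : ℕ} (hi : i < v.1.length) : v.1[i] ≤ top v := by
  have hl := v.2.2
  rw [top, List.getD_eq_getElem _ _ (by omega)]
  rcases Nat.eq_or_lt_of_le (by omega : i ≤ k - 1) with h | h
  · simp [h]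
  · exact List.pairwise_iff_getElem.1 v.2.1 _ _ _ _ h

theorem finite_of_getElem_lt (k N : ℕ) :
    {v : OmegaEQ k | ∀ i (hi : i < v.1.length), v.1[i] < N}.Finite := by
  refine Set.Finite.of_finite_image (f := fun v (i : Fin k) => v.1[(i : ℕ)]'(by rw [v.2.2]; exact i.2))
    ((Set.Finite.pi' fun _ : Fin k => Set.finite_lt_nat N).subset ?_) ?_
  · rintro _ ⟨v, hv, rfl⟩ i
    exact hv _ _
  · intro v _ w _ h
    refine Subtype.ext (List.ext_getElem (by rw [v.2.2, w.2.2]) fun i hi hi' => ?_)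
    exact congrFun h ⟨i, by rw [← v.2.2]; exact hi⟩

theorem finite_top_lt (k N : ℕ) : {v : OmegaEQ k | top v < N}.Finite :=
  (finite_of_getElem_lt k N).subset fun _ hv _ hi => (getElem_le_top _ hi).trans_lt hv

/-- The sequences that extend `s` and whose other entries lie between two given numbers are covered
by a finite approximation which contains no elements outside this range. -/
theorem exists_mem_AR {k : ℕ} (hk : 1 ≤ k) {s : List ℕ} (hs : s.Pairwise (· ≤ ·))
    (hsk : s.length < k) {N : ℕ} (hN : ∀ a ∈ s, a ≤ N) (M : ℕ) :
    ∃ E : Finset (OmegaEQ k), (∀ v ∈ E, N ≤ top v ∧ top v < M) ∧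
      (∀ v : OmegaEQ k, v.1.take s.length = s → N ≤ v.1.getD s.length 0 → top v < M → v ∈ E) ∧
      (E.Nonempty → E ∈ AR k) := by
  set X : Set (OmegaEQ k) := {v | ∃ u : OmegaEQ k, shiftTree s hs N hN u.toLE = v.toLE} with hX
  have hfin : {v | v ∈ X ∧ top v < M}.Finite := (finite_top_lt k M).subset fun v hv => hv.2
  refine ⟨hfin.toFinset, ?_, ?_, ?_⟩
  · intro v hv
    rw [Set.Finite.mem_toFinset] at hv
    obtain ⟨⟨u, hu⟩, hv⟩ := hv
    refine ⟨?_, hv⟩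
    have hu' : u.1.mapIdx (shiftEntry s N) = v.1 := congrArg Subtype.val hu
    have hl := u.2.2
    rw [top, List.getD_eq_getElem _ _ (by rw [v.2.2]; omega)]
    simp only [← hu', List.getElem_mapIdx]
    -- The last position lies beyond the stem, so this holds also for members of `X` that do not
    -- extend `s`.
    rw [shiftEntry_of_length_le (by omega)]
    exact Nat.le_add_right _ _
  · intro v hvs hvN hvM
    rw [Set.Finite.mem_toFinset]
    refine ⟨?_, hvM⟩
    have hvl := v.2.2
    have hNv : ∀ i (hi : i < v.1.length), s.length ≤ i → N ≤ v.1[i] := by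
      intro i hi hsi
      rw [List.getD_eq_getElem _ _ (by omega)] at hvN
      rcases hsi.eq_or_lt with h | h
      · subst h; exact hvN
      · exact hvN.trans (List.pairwise_iff_getElem.1 v.2.1 _ _ _ _ h)
    -- The preimage has zeros along the stem, which encode `s`, and the remaining entries shifted
    -- down by `N`.
    refine ⟨⟨v.1.mapIdx fun i a => if i < s.length then 0 else a - N, ?_, ?_⟩, ?_⟩
    · rw [List.pairwise_iff_getElem]
      intro i i' hi hi' hlt
      rw [List.getElem_mapIdx, List.getElem_mapIdx]
      rw [List.length_mapIdx] at hi hi'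
      have := List.pairwise_iff_getElem.1 v.2.1 i i' hi hi' hlt
      split_ifs <;> omega
    · rw [List.length_mapIdx, hvl]
    · refine Subtype.ext (List.ext_getElem ?_ ?_)
      · simp [shiftTree, OmegaEQ.toLE]
      · intro i hi hi'
        simp only [shiftTree, OmegaEQ.toLE, List.getElem_mapIdx]
        have hiv : i < v.1.length := hi'
        by_cases hlt : i < s.length
        · rw [if_pos hlt, shiftEntry, if_pos ⟨hlt, rfl⟩, List.getD_eq_getElem _ _ hlt]
          have : s[i] = (v.1.take s.length)[i]'(by rw [List.length_take]; omega) := by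
            congr 1
            exact hvs.symm
          rw [this, List.getElem_take]
        · rw [if_neg hlt, shiftEntry_of_length_le (not_lt.1 hlt)]
          have := hNv i hiv (not_lt.1 hlt)
          omega
  · intro hne
    refine ⟨hne, X, ⟨_, isTree_shiftTree s hs N hN, rfl⟩, hfin.toFinset.card, ?_, rfl, ?_⟩
    · intro v hv
      exact ((Set.Finite.mem_toFinset _).1 hv).1
    · intro v hv w hw hwE
      rw [Set.Finite.mem_toFinset] at hv hwE
      -- Since `≺` compares last entries first, bounding the last entry cuts off an initial part of
      -- `X`.
      refine prec_of_top_lt hk (hv.2.trans_le ?_)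
      by_contra hcon
      exact hwE ⟨hw, not_le.1 hcon⟩

/-- The lower `ℓ_p`-estimate for the blocks of a vector which is supported by the extensions of a
fixed sequence. -/
theorem le_tkNorm_of_blocks {k d : ℕ} (hk : 1 ≤ k) {θ : ℝ} (hθ : θ ∈ Set.Ioo (0 : ℝ) 1) {p : ℝ}
    (hd : 2 ≤ d) (hp : 1 < p) (hθp : θ = ((d : ℝ)⁻¹) ^ (1 - 1 / p)) {s : List ℕ}
    (hs : s.Pairwise (· ≤ ·)) (hsk : s.length < k) {N : ℕ → ℕ} (hNmono : StrictMono N)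
    (hN : ∀ a ∈ s, a ≤ N 0) (φ : OmegaEQ k → ℕ) (x : OmegaEQ k →₀ ℝ)
    (hx : ∀ v, x v ≠ 0 → v.1.take s.length = s ∧ N (φ v) ≤ v.1.getD s.length 0 ∧
      top v < N (φ v + 1)) (F : Finset ℕ) :
    ((2 * d : ℝ)⁻¹) ^ (1 - 1 / p) *
      (∑ i ∈ F, tkNorm k d θ (proj (φ ⁻¹' {i}) x) ^ p) ^ (1 / p) ≤ tkNorm k d θ x := by
  classical
  have hsub : ∀ A B : Set (OmegaEQ k), A ⊆ B →
      tkNorm k d θ (proj A x) ≤ tkNorm k d θ (proj B x) := by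
    intro A B h
    rw [← Set.inter_eq_left.2 h, ← proj_proj]
    exact tkNorm_proj_le hθ _ _
  refine (rpow_sum_le_of_split hd hp hθp (fun I => tkNorm k d θ (proj {v | φ v ∈ I} x))
    (fun i => tkNorm k d θ (proj (φ ⁻¹' {i}) x)) (fun I => tkNorm_nonneg hθ _) ?_
    (fun i => tkNorm_nonneg hθ _) ?_ ?_ F).trans (tkNorm_proj_le hθ _ _)
  · exact fun I I' h => hsub _ _ fun v hv => h hv
  · intro I i hi
    exact hsub _ _ fun v hv => by
      rw [Set.mem_preimage, Set.mem_singleton_iff] at hv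
      rw [Set.mem_ofPred_eq, hv]
      exact hi
  · intro I h hI hlt
    -- For each group of blocks, a member of `AR k` covering it whose last entries stay between the
    -- smallest and largest block of the group. Successive groups therefore get successive sets.
    have hE : ∀ l, ∃ E : Finset (OmegaEQ k),
        (∀ v ∈ E, ∃ i ∈ h l, ∃ i' ∈ h l, N i ≤ top v ∧ top v < N (i' + 1)) ∧
        (∀ v, x v ≠ 0 → φ v ∈ h l → v ∈ E) ∧ (E.Nonempty → E ∈ AR k) := by
      intro l
      rcases (h l).eq_empty_or_nonempty with h0 | hne
      · exact ⟨∅, by simp, by simp [h0], by simp⟩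
      · obtain ⟨E, hE1, hE2, hE3⟩ := exists_mem_AR hk hs hsk
          (fun a ha => (hN a ha).trans (hNmono.monotone (Nat.zero_le ((h l).min' hne))))
          (N ((h l).max' hne + 1))
        refine ⟨E, fun v hv => ⟨_, Finset.min'_mem _ hne, _, Finset.max'_mem _ hne, hE1 v hv⟩,
          fun v hv hvl => ?_, hE3⟩
        obtain ⟨h1, h2, h3⟩ := hx v hv
        refine hE2 v h1 ((hNmono.monotone (Finset.min'_le _ _ hvl)).trans h2)
          (h3.trans_le (hNmono.monotone (Nat.succ_le_succ (Finset.le_max' _ _ hvl))))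
    choose E hE1 hE2 hE3 using hE
    have hle : ∀ l, tkNorm k d θ (proj {v | φ v ∈ h l} x) ≤
        tkNorm k d θ (restrict (E l) (proj {v | φ v ∈ I} x)) := by
      intro l
      rw [restrict_eq_proj, proj_proj]
      have : proj {v | φ v ∈ h l} x =
          proj ({v | φ v ∈ h l} ∩ ((E l : Set (OmegaEQ k)) ∩ {v | φ v ∈ I})) x := by
        refine proj_congr fun v hv => ⟨fun hvl => ⟨hvl, hE2 l v hv hvl, hI l hvl⟩, fun hv => hv.1⟩
      rw [this]
      exact hsub _ _ Set.inter_subset_right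
    -- Members of `AR k` are nonempty, so the groups with an empty set are dropped and the rest
    -- reindexed in increasing order.
    set P : Finset (Fin d) := Finset.univ.filter fun l => (E l).Nonempty with hP
    have hsum : ∑ l, tkNorm k d θ (restrict (E l) (proj {v | φ v ∈ I} x)) =
        ∑ l : Fin P.card, tkNorm k d θ (restrict (E (P.orderEmbOfFin rfl l))
          (proj {v | φ v ∈ I} x)) := by
      refine Eq.trans ?_ (Finset.sum_map Finset.univ (P.orderEmbOfFin rfl).toEmbedding
        fun l => tkNorm k d θ (restrict (E l) (proj {v | φ v ∈ I} x)))
      have hmap : (Finset.univ : Finset (Fin P.card)).map (P.orderEmbOfFin rfl).toEmbedding = P :=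
        Finset.map_orderEmbOfFin_univ _ _
      rw [hmap]
      refine (Finset.sum_subset (Finset.subset_univ _) fun l _ hl => ?_).symm
      have : E l = ∅ := by
        by_contra hne
        exact hl (Finset.mem_filter.2 ⟨Finset.mem_univ _, Finset.nonempty_iff_ne_empty.2 hne⟩)
      rw [this, restrict_eq_proj, proj_eq_zero (by simp)]
      exact (c00Norm k d ⟨θ, hθ⟩).map_zero'
    refine (mul_le_mul_of_nonneg_left (Finset.sum_le_sum fun l _ => hle l) hθ.1.le).trans ?_
    rw [hsum]
    rcases Nat.eq_zero_or_pos P.card with h0 | hpos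
    · have : IsEmpty (Fin P.card) := by rw [h0]; infer_instance
      rw [Finset.univ_eq_empty, Finset.sum_empty, mul_zero]
      exact tkNorm_nonneg hθ _
    · refine sum_tkNorm_restrict_le hθ _ ⟨hpos, ?_, fun l => hE3 _ ?_, fun l l' hl v hv w hw => ?_⟩
      · exact (Finset.card_le_univ P).trans_eq (Fintype.card_fin d)
      · exact (Finset.mem_filter.1 (Finset.orderEmbOfFin_mem P rfl l)).2
      · obtain ⟨_, _, i, hi, _, hvi⟩ := hE1 _ v hv
        obtain ⟨i', hi', _, _, hwi, _⟩ := hE1 _ w hw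
        refine prec_of_top_lt hk (hvi.trans_le (le_trans (hNmono.monotone ?_) hwi))
        exact hlt _ _ ((P.orderEmbOfFin rfl).strictMono hl) i hi i' hi'

/-! ### Block sequences supported by the extensions of a fixed sequence -/

/-- The index of the interval `[N i, N (i + 1))` which contains the last entry of a sequence. -/
def blockIndex {k : ℕ} (N : ℕ → ℕ) (v : OmegaEQ k) : ℕ :=
  ((Finset.range (top v)).filter fun i => N (i + 1) ≤ top v).card

theorem blockIndex_mono {k : ℕ} (hk : 1 ≤ k) (N : ℕ → ℕ) (v w : OmegaEQ k)
    (h : Prec v.1 w.1) : blockIndex N v ≤ blockIndex N w := by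
  have := top_le_of_prec hk h
  refine Finset.card_le_card fun i hi => ?_
  rw [Finset.mem_filter, Finset.mem_range] at hi ⊢
  omega

theorem blockIndex_eq {k : ℕ} {N : ℕ → ℕ} (hN : StrictMono N) {v : OmegaEQ k} {i : ℕ}
    (h1 : N i ≤ top v) (h2 : top v < N (i + 1)) : blockIndex N v = i := by
  rw [blockIndex]
  convert Finset.card_range i using 2
  ext i'
  rw [Finset.mem_filter, Finset.mem_range, Finset.mem_range]
  constructor
  · rintro ⟨-, h⟩
    have := hN.lt_iff_lt.1 (h.trans_lt h2)
    omega
  · intro h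
    have h3 := hN.monotone (Nat.succ_le_of_lt h)
    -- `i' + 1 ≤ N (i' + 1) ≤ top v`, so the cutoff at `top v` in `blockIndex` omits nothing.
    have h4 := hN.id_le (i' + 1)
    simp only [id] at h4
    simp only [Nat.succ_eq_add_one] at h3
    omega

theorem tkNorm_smul {k d : ℕ} {θ : ℝ} (hθ : θ ∈ Set.Ioo (0 : ℝ) 1) (c : ℝ)
    (x : OmegaEQ k →₀ ℝ) : tkNorm k d θ (c • x) = |c| * tkNorm k d θ x :=
  norm_smul (β := C00 k d ⟨θ, hθ⟩) c x

theorem rpow_sum_const_mul {p : ℝ} (hp : 0 < p) (F : Finset ℕ) (a : ℕ → ℝ) {B : ℝ} (hB : 0 ≤ B) :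
    (∑ i ∈ F, (|a i| * B) ^ p) ^ (1 / p) = B * (∑ i ∈ F, |a i| ^ p) ^ (1 / p) := by
  simp only [Real.mul_rpow (abs_nonneg _) hB]
  rw [← Finset.sum_mul, Real.mul_rpow (Finset.sum_nonneg fun i _ => Real.rpow_nonneg (abs_nonneg _) _)
    (Real.rpow_nonneg hB _), ← Real.rpow_mul hB, mul_one_div_cancel hp.ne', Real.rpow_one, mul_comm]

section Blocks

variable {k d : ℕ} {θ : ℝ} {N : ℕ → ℕ} {u : ℕ → OmegaEQ k →₀ ℝ}

theorem proj_blockIndex_sum (hNmono : StrictMono N)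
    (hu : ∀ i v, u i v ≠ 0 → N i ≤ top v ∧ top v < N (i + 1)) (F : Finset ℕ) (a : ℕ → ℝ) (i : ℕ) :
    proj (blockIndex N ⁻¹' {i}) (∑ i ∈ F, a i • u i) = if i ∈ F then a i • u i else 0 := by
  have hself : proj (blockIndex N ⁻¹' {i}) (u i) = u i := proj_eq_self fun v hv =>
    blockIndex_eq hNmono (hu i v hv).1 (hu i v hv).2
  have hother : ∀ i', i' ≠ i → proj (blockIndex N ⁻¹' {i}) (u i') = 0 := fun i' hne =>
    proj_eq_zero fun v hv => by
      by_contra h0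
      exact hne ((blockIndex_eq hNmono (hu i' v h0).1 (hu i' v h0).2).symm.trans hv)
  rw [map_sum]
  simp only [map_smul]
  split_ifs with hi
  · rw [Finset.sum_eq_single i, hself]
    · intro i' _ hne
      rw [hother i' hne, smul_zero]
    · exact fun h => absurd hi h
  · refine Finset.sum_eq_zero fun i' hi' => ?_
    rw [hother i' fun h => hi (h ▸ hi'), smul_zero]

theorem exists_mem_of_sum_ne_zero {F : Finset ℕ} {a : ℕ → ℝ} {v : OmegaEQ k}
    (h : (∑ i ∈ F, a i • u i) v ≠ 0) : ∃ i ∈ F, u i v ≠ 0 := by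
  rw [Finsupp.finsetSum_apply] at h
  obtain ⟨i, hi, hv⟩ := Finset.exists_ne_zero_of_sum_ne_zero h
  exact ⟨i, hi, fun h0 => hv (by rw [Finsupp.smul_apply, h0, smul_zero])⟩

theorem tkNorm_sum_le_of_blocks (hk : 1 ≤ k) (hθ : θ ∈ Set.Ioo (0 : ℝ) 1) {p : ℝ}
    (hp : 1 < p) (hdp : θ ^ p * (d : ℝ) ^ (p - 1) ≤ 1) (hNmono : StrictMono N)
    (hu : ∀ i v, u i v ≠ 0 → N i ≤ top v ∧ top v < N (i + 1)) {B : ℝ} (hB : 0 ≤ B)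
    (huB : ∀ i, tkNorm k d θ (u i) ≤ B) (F : Finset ℕ) (a : ℕ → ℝ) :
    tkNorm k d θ (∑ i ∈ F, a i • u i) ≤ θ⁻¹ * 2 * (B * (∑ i ∈ F, |a i| ^ p) ^ (1 / p)) := by
  rw [← rpow_sum_const_mul (by linarith) F a hB]
  refine tkNorm_le_of_blocks hθ hp hdp (blockIndex_mono hk N)
    (fun i => mul_nonneg (abs_nonneg (a i)) hB) F _ (fun v hv => ?_) fun i => ?_
  · obtain ⟨i, hi, hv⟩ := exists_mem_of_sum_ne_zero hv
    rwa [blockIndex_eq hNmono (hu i v hv).1 (hu i v hv).2]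
  · rw [proj_blockIndex_sum hNmono hu]
    split_ifs
    · rw [tkNorm_smul hθ]
      exact mul_le_mul_of_nonneg_left (huB i) (abs_nonneg _)
    · exact ((c00Norm k d ⟨θ, hθ⟩).map_zero').trans_le (mul_nonneg (abs_nonneg (a i)) hB)

/-- Only the components on the tails of `s` have to be large: projecting to `G` discards all else
without increasing the norm, and what remains satisfies the support condition of
`le_tkNorm_of_blocks`. -/
theorem le_tkNorm_sum_of_blocks (hk : 1 ≤ k) (hθ : θ ∈ Set.Ioo (0 : ℝ) 1) {p : ℝ}
    (hd : 2 ≤ d) (hp : 1 < p) (hθp : θ = ((d : ℝ)⁻¹) ^ (1 - 1 / p)) {s : List ℕ}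
    (hs : s.Pairwise (· ≤ ·)) (hsk : s.length < k) (hNmono : StrictMono N)
    (hN : ∀ a ∈ s, a ≤ N 0) (hu : ∀ i v, u i v ≠ 0 → N i ≤ top v ∧ top v < N (i + 1))
    {δ : ℝ} (hδ : 0 ≤ δ) (huδ : ∀ i, δ ≤ tkNorm k d θ
      (proj {v | v.1.take s.length = s ∧ N i ≤ v.1.getD s.length 0} (u i)))
    (F : Finset ℕ) (a : ℕ → ℝ) :
    ((2 * d : ℝ)⁻¹) ^ (1 - 1 / p) * (δ * (∑ i ∈ F, |a i| ^ p) ^ (1 / p)) ≤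
      tkNorm k d θ (∑ i ∈ F, a i • u i) := by
  have hp0 : 0 < p := by linarith
  set G : Set (OmegaEQ k) :=
    {v | v.1.take s.length = s ∧ N (blockIndex N v) ≤ v.1.getD s.length 0} with hG
  refine le_trans ?_ (tkNorm_proj_le hθ G _)
  refine le_trans ?_ (le_tkNorm_of_blocks hk hθ hd hp hθp hs hsk hNmono hN (blockIndex N) _
    (fun v hv => ?_) F)
  · rw [← rpow_sum_const_mul hp0 F a hδ]
    refine mul_le_mul_of_nonneg_left ?_ (Real.rpow_nonneg (by positivity) _)
    refine Real.rpow_le_rpow (Finset.sum_nonneg fun i _ =>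
      Real.rpow_nonneg (mul_nonneg (abs_nonneg _) hδ) _) (Finset.sum_le_sum fun i hi => ?_)
      (by positivity)
    refine Real.rpow_le_rpow (mul_nonneg (abs_nonneg _) hδ) ?_ hp0.le
    rw [proj_proj, Set.inter_comm, ← proj_proj, proj_blockIndex_sum hNmono hu, if_pos hi, map_smul,
      tkNorm_smul hθ]
    refine mul_le_mul_of_nonneg_left ((huδ i).trans_eq ?_) (abs_nonneg _)
    congr 1
    refine proj_congr fun v hv => ?_
    rw [hG, Set.mem_ofPred_eq, Set.mem_ofPred_eq,
      blockIndex_eq hNmono (hu i v hv).1 (hu i v hv).2]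
  · obtain ⟨hvG, hv⟩ := proj_apply_ne_zero.1 hv
    obtain ⟨i, -, hv⟩ := exists_mem_of_sum_ne_zero hv
    refine ⟨hvG.1, hvG.2, ?_⟩
    rw [blockIndex_eq hNmono (hu i v hv).1 (hu i v hv).2]
    exact (hu i v hv).2

end Blocks

/-! ### Sequences equivalent to the unit vector basis of `ℓ_p` -/

/-- The map `f ↦ ∑ f i • x i` is bounded and bounded below on `ℓ_p`, hence an isomorphism onto its
range, which is closed and stays in the closed subspace `Z`. -/
theorem exists_submodule_equiv_lp {E : Type*} [NormedAddCommGroup E] [NormedSpace ℝ E]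
    [CompleteSpace E] {p : ℝ} [Fact (1 ≤ ENNReal.ofReal p)] (hp : 0 < p) (x : ℕ → E) {c C : ℝ}
    (hc : 0 < c) (hlower : ∀ (F : Finset ℕ) (a : ℕ → ℝ),
      c * (∑ i ∈ F, |a i| ^ p) ^ (1 / p) ≤ ‖∑ i ∈ F, a i • x i‖)
    (hupper : ∀ (F : Finset ℕ) (a : ℕ → ℝ),
      ‖∑ i ∈ F, a i • x i‖ ≤ C * (∑ i ∈ F, |a i| ^ p) ^ (1 / p))
    (Z : Submodule ℝ E) (hZ : IsClosed (Z : Set E)) (hxZ : ∀ i, x i ∈ Z) :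
    ∃ Y : Submodule ℝ E, IsClosed (Y : Set E) ∧ Y ≤ Z ∧
      Nonempty (Y ≃L[ℝ] lp (fun _ : ℕ => ℝ) (ENNReal.ofReal p)) := by
  have htoReal : (ENNReal.ofReal p).toReal = p := ENNReal.toReal_ofReal hp.le
  have hnorm : ∀ f : lp (fun _ : ℕ => ℝ) (ENNReal.ofReal p),
      HasSum (fun i => |f i| ^ p) (‖f‖ ^ p) := by
    intro f
    have := lp.hasSum_norm (by rw [htoReal]; exact hp) f
    rwa [htoReal] at this
  have hnorm' : ∀ f : lp (fun _ : ℕ => ℝ) (ENNReal.ofReal p), (‖f‖ ^ p) ^ (1 / p) = ‖f‖ := by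
    intro f
    rw [← Real.rpow_mul (norm_nonneg _), mul_one_div_cancel hp.ne', Real.rpow_one]
  have hsum : ∀ f : lp (fun _ : ℕ => ℝ) (ENNReal.ofReal p), Summable fun i => f i • x i := by
    intro f
    rw [summable_iff_vanishing_norm]
    intro ε hε
    -- `C` is not assumed positive, so it is replaced by `|C| + 1` before dividing.
    have hC : 0 < |C| + 1 := by positivity
    obtain ⟨s, hs⟩ := summable_iff_vanishing_norm.1 (hnorm f).summable ((ε / (|C| + 1)) ^ p)
      (by positivity)
    refine ⟨s, fun t ht => (hupper t f).trans_lt ?_⟩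
    have h0 : 0 ≤ ∑ i ∈ t, |f i| ^ p := Finset.sum_nonneg fun i _ => Real.rpow_nonneg (abs_nonneg _) _
    have h1 := hs t ht
    rw [Real.norm_of_nonneg h0] at h1
    have h2 : (∑ i ∈ t, |f i| ^ p) ^ (1 / p) < ε / (|C| + 1) := by
      have := Real.rpow_lt_rpow h0 h1 (show 0 < 1 / p by positivity)
      rwa [← Real.rpow_mul (by positivity), mul_one_div_cancel hp.ne', Real.rpow_one] at this
    rw [lt_div_iff₀ hC] at h2
    have h3 : C ≤ |C| + 1 := (le_abs_self C).trans (by linarith)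
    nlinarith [Real.rpow_nonneg h0 (1 / p)]
  have hlim : ∀ f : lp (fun _ : ℕ => ℝ) (ENNReal.ofReal p),
      Filter.Tendsto (fun F : Finset ℕ => (∑ i ∈ F, |f i| ^ p) ^ (1 / p)) Filter.atTop
        (nhds ‖f‖) := by
    intro f
    rw [← hnorm' f]
    exact (hnorm f).rpow_const (Or.inr (by positivity))
  let L₀ : lp (fun _ : ℕ => ℝ) (ENNReal.ofReal p) →ₗ[ℝ] E :=
    { toFun := fun f => ∑' i, f i • x i
      map_add' := fun f g => by
        rw [← (hsum f).tsum_add (hsum g)]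
        exact tsum_congr fun i => add_smul _ _ _
      map_smul' := fun r f => by
        rw [RingHom.id_apply, ← (hsum f).tsum_const_smul r]
        exact tsum_congr fun i => mul_smul _ _ _ }
  have hL₀ : ∀ f, HasSum (fun i => f i • x i) (L₀ f) := fun f => (hsum f).hasSum
  let L := L₀.mkContinuous C fun f =>
    le_of_tendsto_of_tendsto' (hL₀ f).norm ((hlim f).const_mul C) fun F => hupper F f
  have hLlow : ∀ f, c * ‖f‖ ≤ ‖L f‖ := fun f =>
    le_of_tendsto_of_tendsto' ((hlim f).const_mul c) (hL₀ f).norm fun F => hlower F f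
  have hanti : AntilipschitzWith (Real.toNNReal c⁻¹) L := by
    refine L.antilipschitz_of_bound fun f => ?_
    rw [Real.coe_toNNReal _ (inv_nonneg.2 hc.le), inv_mul_eq_div, le_div_iff₀' hc]
    exact hLlow f
  have hclosed : IsClosed (Set.range L) := hanti.isClosed_range L.uniformContinuous
  refine ⟨L.range, ?_, ?_, ⟨(L.equivRange hanti.injective hclosed).symm⟩⟩
  · rw [LinearMap.coe_range]
    exact hclosed
  · rintro _ ⟨f, rfl⟩
    exact hZ.mem_of_tendsto (hL₀ f)
      (Filter.Eventually.of_forall fun F => Z.sum_mem fun i _ => Z.smul_mem _ (hxZ i))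

/-! ### Coordinate projections of the completion -/

theorem proj_add_proj_compl {k : ℕ} (A : Set (OmegaEQ k)) (x : OmegaEQ k →₀ ℝ) :
    proj A x + proj Aᶜ x = x := by
  ext v
  rw [Finsupp.add_apply, proj_apply, proj_apply]
  by_cases hv : v ∈ A <;> simp [hv]

theorem proj_eq_sum {k : ℕ} {A : Set (OmegaEQ k)} (hA : A.Finite) (x : OmegaEQ k →₀ ℝ) :
    proj A x = ∑ v ∈ hA.toFinset, x v • (Finsupp.single v 1 : OmegaEQ k →₀ ℝ) := by
  ext w
  rw [Finsupp.finsetSum_apply, proj_apply]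
  simp only [Finsupp.smul_apply, smul_eq_mul]
  by_cases hw : w ∈ A
  · rw [if_pos hw, Finset.sum_eq_single w]
    · simp
    · intro v _ hne
      rw [Finsupp.single_eq_of_ne hne.symm, mul_zero]
    · exact fun h => absurd ((Set.Finite.mem_toFinset hA).2 hw) h
  · rw [if_neg hw]
    refine (Finset.sum_eq_zero fun v hv => ?_).symm
    have hne : w ≠ v := fun h => hw (h ▸ (Set.Finite.mem_toFinset hA).1 hv)
    rw [Finsupp.single_eq_of_ne hne, mul_zero]

section Completion

variable {k d : ℕ} {θ : Set.Ioo (0 : ℝ) 1}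

/-- The restriction to a set of coordinates, as an operator on `c₀₀(ω^{k})`. -/
noncomputable def c00Proj (A : Set (OmegaEQ k)) : C00 k d θ →L[ℝ] C00 k d θ :=
  LinearMap.mkContinuous
    { toFun := fun x => (proj A x : OmegaEQ k →₀ ℝ)
      map_add' := fun x y => (proj A).map_add x y
      map_smul' := fun c x => (proj A).map_smul c x } 1
    fun x => by
      rw [one_mul]
      exact tkNorm_proj_le θ.2 A x

theorem norm_c00Proj_le (A : Set (OmegaEQ k)) (x : C00 k d θ) : ‖c00Proj A x‖ ≤ ‖x‖ :=
  tkNorm_proj_le θ.2 A x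

/-- The restriction to a set of coordinates, as an operator on `T_k(d, θ)`. -/
noncomputable def projT (A : Set (OmegaEQ k)) : T k d θ →L[ℝ] T k d θ :=
  (UniformSpace.Completion.toComplL.comp (c00Proj A)).extend
    (UniformSpace.Completion.toComplL (𝕜 := ℝ) (E := C00 k d θ))

theorem projT_coe (A : Set (OmegaEQ k)) (x : C00 k d θ) :
    projT A (x : T k d θ) = ((c00Proj A x : C00 k d θ) : T k d θ) :=
  ContinuousLinearMap.extend_eq _ UniformSpace.Completion.denseRange_coe
    (UniformSpace.Completion.isUniformInducing_coe _) x

theorem norm_projT_le (A : Set (OmegaEQ k)) (z : T k d θ) : ‖projT A z‖ ≤ ‖z‖ := by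
  induction z using UniformSpace.Completion.induction_on with
  | hp => exact isClosed_le (projT A).continuous.norm continuous_norm
  | ih x =>
    rw [projT_coe, UniformSpace.Completion.norm_coe, UniformSpace.Completion.norm_coe]
    exact norm_c00Proj_le A x

theorem projT_add_projT_compl (A : Set (OmegaEQ k)) (z : T k d θ) :
    projT A z + projT Aᶜ z = z := by
  induction z using UniformSpace.Completion.induction_on with
  | hp => exact isClosed_eq ((projT A).continuous.add (projT Aᶜ).continuous) continuous_id
  | ih x =>
    rw [projT_coe, projT_coe, ← UniformSpace.Completion.coe_add]
    exact congrArg _ (proj_add_proj_compl A x)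

theorem projT_univ (z : T k d θ) : projT Set.univ z = z := by
  induction z using UniformSpace.Completion.induction_on with
  | hp => exact isClosed_eq (projT _).continuous continuous_id
  | ih x =>
    rw [projT_coe]
    exact congrArg _ (proj_eq_self fun _ _ => Set.mem_univ _)

/-- On finitely supported vectors the values lie in the span of the unit vectors indexed by `A`;
this span is finite-dimensional, hence closed, so density gives the rest. -/
theorem exists_finiteDimensional_range_projT {A : Set (OmegaEQ k)} (hA : A.Finite) :
    ∃ W : Submodule ℝ (T k d θ), FiniteDimensional ℝ W ∧ ∀ z, projT A z ∈ W := by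
  set e : OmegaEQ k → T k d θ := fun v =>
    ((show C00 k d θ from (Finsupp.single v 1 : OmegaEQ k →₀ ℝ) : C00 k d θ) : T k d θ) with he
  set W : Submodule ℝ (T k d θ) := Submodule.span ℝ (e '' A) with hW
  have hWfin : FiniteDimensional ℝ W := FiniteDimensional.span_of_finite ℝ (hA.image e)
  refine ⟨W, hWfin, fun z => ?_⟩
  induction z using UniformSpace.Completion.induction_on with
  | hp => exact (Submodule.closed_of_finiteDimensional W).preimage (projT A).continuous
  | ih x =>
    set y : OmegaEQ k →₀ ℝ := x with hy
    have hx : c00Proj A x = ∑ v ∈ hA.toFinset, y v •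
        (show C00 k d θ from (Finsupp.single v 1 : OmegaEQ k →₀ ℝ)) := proj_eq_sum hA y
    rw [projT_coe, hx]
    have : ((∑ v ∈ hA.toFinset, y v •
        (show C00 k d θ from (Finsupp.single v 1 : OmegaEQ k →₀ ℝ)) : C00 k d θ) : T k d θ) =
        ∑ v ∈ hA.toFinset, y v • e v := by
      have := map_sum (UniformSpace.Completion.toComplL (𝕜 := ℝ) (E := C00 k d θ))
        (fun v => y v •
          (show C00 k d θ from (Finsupp.single v 1 : OmegaEQ k →₀ ℝ))) hA.toFinset
      refine this.trans (Finset.sum_congr rfl fun v _ => ?_)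
      rw [map_smul]
      rfl
    rw [this]
    exact W.sum_mem fun v hv => W.smul_mem _
      (Submodule.subset_span ⟨v, (Set.Finite.mem_toFinset hA).1 hv, rfl⟩)

/-- The kernel of a coordinate projection of finite rank has finite codimension. -/
theorem not_finiteDimensional_inf_ker {A : Set (OmegaEQ k)} (hA : A.Finite)
    {Z : Submodule ℝ (T k d θ)} (hZ : ¬ FiniteDimensional ℝ Z) :
    ¬ FiniteDimensional ℝ (Z ⊓ (projT A : T k d θ →L[ℝ] T k d θ).ker : Submodule ℝ (T k d θ)) := by
  intro hfin
  obtain ⟨W, hW, hWA⟩ := exists_finiteDimensional_range_projT (d := d) (θ := θ) hA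
  refine hZ (Module.Finite.iff_fg.2 (Submodule.fg_of_fg_map_of_fg_inf_ker
    (projT A : T k d θ →L[ℝ] T k d θ).toLinearMap ?_ (Module.Finite.iff_fg.1 hfin)))
  have hle : Z.map (projT A : T k d θ →L[ℝ] T k d θ).toLinearMap ≤ W := by
    rintro _ ⟨z, -, rfl⟩
    exact hWA z
  exact Module.Finite.iff_fg.1 (Submodule.finiteDimensional_of_le hle)

/-! ### Choice of the stem -/

/-- The sequences whose first `j` entries are below `N`. -/
def lowSet (k j N : ℕ) : Set (OmegaEQ k) :=
  {v | ∀ i < j, v.1.getD i 0 < N}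

theorem finite_lowSet (k N : ℕ) : (lowSet k k N).Finite := by
  refine (finite_of_getElem_lt k N).subset fun v hv i hi => ?_
  have := hv i (by rw [← v.2.2]; exact hi)
  rwa [List.getD_eq_getElem _ _ hi] at this

/-- There are a length `j < k` and an infinite-dimensional subspace on which the projection to the
sequences with `j` bounded entries is an isomorphism, whereas for `j + 1` there is no such
subspace. -/
theorem exists_length {Z : Submodule ℝ (T k d θ)} (hZ : ¬ FiniteDimensional ℝ Z) :
    ∃ j < k, ∃ (N₀ : ℕ) (Z' : Submodule ℝ (T k d θ)) (δ : ℝ), Z' ≤ Z ∧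
      ¬ FiniteDimensional ℝ Z' ∧ 0 < δ ∧ (∀ z ∈ Z', δ * ‖z‖ ≤ ‖projT (lowSet k j N₀) z‖) ∧
      ∀ (N : ℕ) (Z'' : Submodule ℝ (T k d θ)), Z'' ≤ Z' → ¬ FiniteDimensional ℝ Z'' →
        ∀ ε > 0, ∃ z ∈ Z'', ‖projT (lowSet k (j + 1) N) z‖ < ε * ‖z‖ := by
  -- Otherwise one passes from `j` to `j + 1` on smaller and smaller subspaces, from `j = 0`, where
  -- the projection is the identity, to `j = k`, where it has finite rank and cannot be bounded
  -- below on an infinite-dimensional space.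
  by_contra! hcon
  have key : ∀ j ≤ k, ∃ (N : ℕ) (Z' : Submodule ℝ (T k d θ)) (δ : ℝ), Z' ≤ Z ∧
      ¬ FiniteDimensional ℝ Z' ∧ 0 < δ ∧ ∀ z ∈ Z', δ * ‖z‖ ≤ ‖projT (lowSet k j N) z‖ := by
    intro j
    induction j with
    | zero =>
      refine fun _ => ⟨0, Z, 1, le_rfl, hZ, one_pos, fun z _ => ?_⟩
      have : lowSet k 0 0 = Set.univ := Set.eq_univ_of_forall fun v i hi => absurd hi (by omega)
      rw [this, projT_univ, one_mul]
    | succ j ih =>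
      intro hj
      obtain ⟨N, Z', δ, h1, h2, h3, h4⟩ := ih (by omega)
      obtain ⟨N', Z'', h5, h6, ε, h7, h8⟩ := hcon j hj N Z' δ h1 h2 h3 h4
      exact ⟨N', Z'', ε, h5.trans h1, h6, h7, h8⟩
  obtain ⟨N, Z', δ, -, h2, h3, h4⟩ := key k le_rfl
  refine not_finiteDimensional_inf_ker (finite_lowSet k N) h2 ?_
  have : Z' ⊓ (projT (lowSet k k N) : T k d θ →L[ℝ] T k d θ).ker = ⊥ := by
    rw [Submodule.eq_bot_iff]
    rintro z ⟨hz, hz0⟩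
    have h := h4 z hz
    have hz0' : projT (lowSet k k N) z = 0 := hz0
    rw [hz0', norm_zero] at h
    exact norm_le_zero_iff.1 (nonpos_of_mul_nonpos_right h h3)
  rw [this]
  infer_instance

/-- The extensions of `s` whose further entries are at least `N`. -/
def tailSet {k : ℕ} (s : List ℕ) (N : ℕ) : Set (OmegaEQ k) :=
  {v | v.1.take s.length = s ∧ N ≤ v.1.getD s.length 0}

theorem tailSet_anti (s : List ℕ) {N M : ℕ} (h : N ≤ M) :
    tailSet (k := k) s M ⊆ tailSet s N :=
  fun _ hv => ⟨hv.1, h.trans hv.2⟩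

theorem tkNorm_proj_mono {A B : Set (OmegaEQ k)} (h : A ⊆ B) (x : OmegaEQ k →₀ ℝ) :
    tkNorm k d θ (proj A x) ≤ tkNorm k d θ (proj B x) := by
  rw [← Set.inter_eq_left.2 h, ← proj_proj]
  exact tkNorm_proj_le θ.2 _ _

theorem tkNorm_proj_union_le (A B : Set (OmegaEQ k)) (x : OmegaEQ k →₀ ℝ) :
    tkNorm k d θ (proj (A ∪ B) x) ≤ tkNorm k d θ (proj A x) + tkNorm k d θ (proj B x) := by
  have : proj (A ∪ B) x = proj A x + proj (B \ A) x := by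
    ext v
    rw [Finsupp.add_apply, proj_apply, proj_apply, proj_apply]
    by_cases hA : v ∈ A <;> by_cases hB : v ∈ B <;> simp [hA, hB]
  rw [this]
  exact (tkNorm_add_le k d θ.2 _ _).trans
    (add_le_add_right (tkNorm_proj_mono Set.sdiff_subset x) _)

theorem tkNorm_proj_biUnion_le {ι : Type*} (S : Finset ι) (A : ι → Set (OmegaEQ k))
    (x : OmegaEQ k →₀ ℝ) :
    tkNorm k d θ (proj (⋃ i ∈ S, A i) x) ≤ ∑ i ∈ S, tkNorm k d θ (proj (A i) x) := by
  classical
  induction S using Finset.induction_on with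
  | empty =>
    rw [proj_eq_zero (by simp), Finset.sum_empty]
    exact ((c00Norm k d θ).map_zero').le
  | insert a S ha ih =>
    rw [Finset.set_biUnion_insert, Finset.sum_insert ha]
    exact (tkNorm_proj_union_le _ _ x).trans (add_le_add_right ih _)

/-- Look at the entry at index `j`: either it is below `N`, or the sequence is in the tail of its
initial segment of length `j`. Only finitely many such segments have entries below `N₀`. -/
theorem lowSet_subset {j : ℕ} (hj : j < k) {N₀ N : ℕ} (hN : N₀ ≤ N) :
    lowSet k j N₀ ⊆ lowSet k (j + 1) N ∪
      ⋃ s ∈ (finite_of_getElem_lt j N₀).toFinset, tailSet (k := k) s.1 N := by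
  intro v hv
  by_cases hv' : v ∈ lowSet k (j + 1) N
  · exact Or.inl hv'
  right
  have hvl := v.2.2
  have hl : (v.1.take j).length = j := by rw [List.length_take]; omega
  simp only [Set.mem_iUnion]
  refine ⟨⟨v.1.take j, v.2.1.sublist (List.take_sublist _ _), hl⟩, ?_, ?_, ?_⟩
  · rw [Set.Finite.mem_toFinset]
    intro i hi
    have hij : i < j := hl ▸ hi
    have := hv i hij
    rw [List.getD_eq_getElem _ _ (by omega)] at this
    simpa using this
  · simp only [hl]
  · simp only [hl]
    by_contra hcon
    refine hv' fun i hi => ?_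
    rcases Nat.lt_succ_iff_lt_or_eq.1 hi with h | h
    · exact (hv i h).trans_le hN
    · rw [h]; exact not_le.1 hcon

/-- Every infinite-dimensional subspace contains normalized vectors which are arbitrarily close to
finitely supported vectors that live far out and have a large component at the tails of one fixed
sequence `s`. -/
theorem exists_stem {Z : Submodule ℝ (T k d θ)} (hZ : ¬ FiniteDimensional ℝ Z) :
    ∃ (s : List ℕ) (δ : ℝ), s.Pairwise (· ≤ ·) ∧ s.length < k ∧ 0 < δ ∧
      ∀ η > 0, ∀ N : ℕ, ∃ z ∈ Z, ∃ u : C00 k d θ, ‖z‖ = 1 ∧ ‖z - (u : T k d θ)‖ ≤ η ∧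
        (∀ v, (show OmegaEQ k →₀ ℝ from u) v ≠ 0 → N ≤ top v) ∧
        δ ≤ tkNorm k d θ (proj (tailSet s N) (show OmegaEQ k →₀ ℝ from u)) := by
  obtain ⟨j, hj, N₀, Z', δ, hZ'Z, hZ', hδ, hlow, hsmall⟩ := exists_length hZ
  set S := (finite_of_getElem_lt j N₀).toFinset with hS
  -- For the approximating vector `u`, the norm on `lowSet k j N₀` exceeds `7δ/8` and that on
  -- `lowSet k (j + 1) M` is below `5δ/8`. More than `δ/4` is left for the tails of the stems in
  -- `S`, and one of them gets at least `δ'`.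
  set δ' : ℝ := δ / (4 * (S.card + 1)) with hδ'
  have hδ'0 : 0 < δ' := by positivity
  have step : ∀ η > 0, ∀ N : ℕ, ∃ s ∈ S, ∃ z ∈ Z, ∃ u : C00 k d θ, ‖z‖ = 1 ∧ ‖z - (u : T k d θ)‖ ≤ η ∧
      (∀ v, (show OmegaEQ k →₀ ℝ from u) v ≠ 0 → N ≤ top v) ∧
      δ' ≤ tkNorm k d θ (proj (tailSet s.1 N) (show OmegaEQ k →₀ ℝ from u)) := by
    intro η hη N
    set M := max N N₀ with hM
    set A : Set (OmegaEQ k) := {v | top v < N} with hA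
    -- Intersecting with the kernel keeps the subspace infinite-dimensional and makes the vector
    -- vanish where `top v < N`, so that it lives far out.
    obtain ⟨z₀, ⟨hz₀Z, hz₀A⟩, hz₀⟩ := hsmall M _ inf_le_left
      (not_finiteDimensional_inf_ker (finite_top_lt k N) hZ') (δ / 2) (half_pos hδ)
    have hz₀n : 0 < ‖z₀‖ := by
      by_contra hcon
      have : ‖z₀‖ = 0 := le_antisymm (not_lt.1 hcon) (norm_nonneg _)
      rw [this, mul_zero] at hz₀
      exact absurd hz₀ (not_lt.2 (norm_nonneg _))
    set z := ‖z₀‖⁻¹ • z₀ with hz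
    have hzn : ‖z‖ = 1 := by
      rw [hz, norm_smul, norm_inv, norm_norm, inv_mul_cancel₀ hz₀n.ne']
    have hzA : projT A z = 0 := by
      have : projT A z₀ = 0 := hz₀A
      rw [hz, map_smul, this, smul_zero]
    have hzM : ‖projT (lowSet k (j + 1) M) z‖ < δ / 2 := by
      rw [hz, map_smul, norm_smul, norm_inv, norm_norm, inv_mul_lt_iff₀ hz₀n, mul_comm]
      exact hz₀
    have hzZ' : z ∈ Z' := Z'.smul_mem _ hz₀Z
    have hzlow : δ ≤ ‖projT (lowSet k j N₀) z‖ := by simpa [hzn] using hlow z hzZ'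
    obtain ⟨y, hy⟩ : ∃ y : C00 k d θ, ‖z - (y : T k d θ)‖ < min η (δ / 8) := by
      have := UniformSpace.Completion.denseRange_coe (α := C00 k d θ)
      obtain ⟨y, hy⟩ := this.exists_dist_lt z (ε := min η (δ / 8)) (lt_min hη (by positivity))
      exact ⟨y, by rwa [dist_eq_norm] at hy⟩
    -- Removing the coordinates in `A` from `y` does not worsen the approximation, since `z` has
    -- none there.
    set u : C00 k d θ := c00Proj Aᶜ y with hu
    have hzu : ‖z - (u : T k d θ)‖ < min η (δ / 8) := by
      have : z - (u : T k d θ) = projT Aᶜ (z - (y : T k d θ)) := by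
        rw [map_sub, projT_coe, ← hu]
        congr 1
        have := projT_add_projT_compl A z
        rw [hzA, zero_add] at this
        exact this.symm
      rw [this]
      exact (norm_projT_le _ _).trans_lt hy
    have hclose : ∀ B : Set (OmegaEQ k), |‖projT B z‖ - tkNorm k d θ (proj B u)| < δ / 8 := by
      intro B
      have h1 : tkNorm k d θ (proj B u) = ‖projT B (u : T k d θ)‖ := by
        rw [projT_coe, UniformSpace.Completion.norm_coe]
        rfl
      rw [h1]
      refine (abs_norm_sub_norm_le _ _).trans_lt ?_
      rw [← map_sub]
      exact (norm_projT_le _ _).trans_lt (hzu.trans_le (min_le_right _ _))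
    have h1 := abs_lt.1 (hclose (lowSet k j N₀))
    have h2 := abs_lt.1 (hclose (lowSet k (j + 1) M))
    have h3 : tkNorm k d θ (proj (lowSet k j N₀) u) ≤ tkNorm k d θ (proj (lowSet k (j + 1) M) u) +
        ∑ s ∈ S, tkNorm k d θ (proj (tailSet s.1 M) u) :=
      (tkNorm_proj_mono (lowSet_subset hj (le_max_right N N₀)) u).trans
        ((tkNorm_proj_union_le _ _ _).trans
          (add_le_add_right (tkNorm_proj_biUnion_le S (fun s => tailSet s.1 M) u) _))
    have h4 : ∃ s ∈ S, δ' ≤ tkNorm k d θ (proj (tailSet s.1 M) u) := by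
      by_contra! hcon
      have h5 : ∑ s ∈ S, tkNorm k d θ (proj (tailSet s.1 M) u) ≤ S.card * δ' := by
        rw [← nsmul_eq_mul]
        exact Finset.sum_le_card_nsmul _ _ _ fun s hs => (hcon s hs).le
      have h6 : S.card * δ' ≤ δ / 4 := by
        rw [hδ', mul_div_assoc', div_le_div_iff₀ (by positivity) (by positivity)]
        nlinarith
      linarith [h1.1, h1.2, h2.1, h2.2]
    obtain ⟨s, hs, hsδ⟩ := h4
    refine ⟨s, hs, z, hZ'Z hzZ', u, hzn, (hzu.trans_le (min_le_left _ _)).le, fun v hv => ?_,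
      hsδ.trans (tkNorm_proj_mono (tailSet_anti s.1 (le_max_left N N₀)) u)⟩
    have := (proj_apply_ne_zero.1 hv).1
    exact not_lt.1 this
  -- `step` gives a stem depending on `η` and `N`. If each stem failed for some `η s` and `N s`,
  -- then the least `η` and the largest `N` over the finite set `S` would defeat all stems at once.
  by_contra! hcon
  have hex : ∀ s : OmegaEQ j, ∃ η > 0, ∃ N : ℕ, ∀ z ∈ Z, ∀ u : C00 k d θ, ‖z‖ = 1 → ‖z - (u : T k d θ)‖ ≤ η →
      (∀ v, (show OmegaEQ k →₀ ℝ from u) v ≠ 0 → N ≤ top v) →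
      tkNorm k d θ (proj (tailSet s.1 N) (show OmegaEQ k →₀ ℝ from u)) < δ' := fun s =>
    hcon s.1 δ' s.2.1 (by rw [s.2.2]; exact hj) hδ'0
  choose η hη N hN using hex
  obtain ⟨η₀, hη₀, hη₀'⟩ : ∃ η₀ > 0, ∀ s ∈ S, η₀ ≤ η s := by
    rcases S.eq_empty_or_nonempty with h | h
    · exact ⟨1, one_pos, by simp [h]⟩
    · obtain ⟨s, -, hs⟩ := S.exists_min_image η h
      exact ⟨η s, hη s, hs⟩
  obtain ⟨s, hs, z, hz, u, h1, h2, h3, h4⟩ := step η₀ hη₀ (S.sup N)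
  have hle : N s ≤ S.sup N := Finset.le_sup hs
  have := hN s z hz u h1 (h2.trans (hη₀' s hs)) fun v hv => hle.trans (h3 v hv)
  refine absurd (h4.trans (tkNorm_proj_mono (tailSet_anti s.1 hle) _)) (not_le.2 this)

end Completion

/-! ### Block sequences near a subspace and their perturbation -/

/-- A sequence of vectors of `Z` close to a block sequence at the tails of one fixed sequence. -/
theorem exists_block_sequence {k d : ℕ} {θ : Set.Ioo (0 : ℝ) 1} {Z : Submodule ℝ (T k d θ)}
    {s : List ℕ} {δ : ℝ}
    (h : ∀ η > 0, ∀ N : ℕ, ∃ z ∈ Z, ∃ u : C00 k d θ, ‖z‖ = 1 ∧ ‖z - (u : T k d θ)‖ ≤ η ∧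
        (∀ v, (show OmegaEQ k →₀ ℝ from u) v ≠ 0 → N ≤ top v) ∧
        δ ≤ tkNorm k d θ (proj (tailSet s N) (show OmegaEQ k →₀ ℝ from u)))
    (N₀ : ℕ) {η : ℕ → ℝ} (hη : ∀ i, 0 < η i) :
    ∃ (N : ℕ → ℕ) (z : ℕ → T k d θ) (u : ℕ → C00 k d θ), StrictMono N ∧ N 0 = N₀ ∧
      ∀ i, z i ∈ Z ∧ ‖z i‖ = 1 ∧ ‖z i - (u i : T k d θ)‖ ≤ η i ∧
        (∀ v, (show OmegaEQ k →₀ ℝ from u i) v ≠ 0 → N i ≤ top v ∧ top v < N (i + 1)) ∧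
        δ ≤ tkNorm k d θ (proj (tailSet s (N i)) (show OmegaEQ k →₀ ℝ from u i)) := by
  choose z hz u hz1 hzu hu huδ using fun i : ℕ => h (η i) (hη i)
  -- The next block starts beyond the support of the current vector; `N + 1` ensures strict growth.
  let next : ℕ → ℕ → ℕ := fun i N =>
    max (N + 1) ((Finsupp.support (show OmegaEQ k →₀ ℝ from u i N)).sup top + 1)
  let N : ℕ → ℕ := fun i => Nat.rec N₀ next i
  have hN : ∀ i, N (i + 1) = next i (N i) := fun i => rfl
  refine ⟨N, fun i => z i (N i), fun i => u i (N i), strictMono_nat_of_lt_succ fun i => ?_, rfl,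
    fun i => ⟨hz _ _, hz1 _ _, hzu _ _, fun v hv => ⟨hu _ _ v hv, ?_⟩, huδ _ _⟩⟩
  · rw [hN]
    exact Nat.lt_of_succ_le (le_max_left _ _)
  · rw [hN]
    refine lt_of_lt_of_le ?_ (le_max_right _ _)
    exact Nat.lt_succ_of_le (Finset.le_sup (f := top) (Finsupp.mem_support_iff.2 hv))

/-- Each coefficient is at most the `ℓ_p`-norm of all of them, and the errors sum geometrically to
at most `η`. -/
theorem norm_sum_sub_sum_le {E : Type*} [NormedAddCommGroup E] [NormedSpace ℝ E] {p : ℝ}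
    (hp : 0 < p) {z u : ℕ → E} {η : ℝ} (hη : 0 ≤ η)
    (h : ∀ i, ‖z i - u i‖ ≤ η / 2 / 2 ^ i) (F : Finset ℕ) (a : ℕ → ℝ) :
    ‖∑ i ∈ F, a i • z i - ∑ i ∈ F, a i • u i‖ ≤ η * (∑ i ∈ F, |a i| ^ p) ^ (1 / p) := by
  set R := (∑ i ∈ F, |a i| ^ p) ^ (1 / p) with hR
  have hap : ∀ i, 0 ≤ |a i| ^ p := fun i => Real.rpow_nonneg (abs_nonneg _) p
  have hR0 : 0 ≤ R := Real.rpow_nonneg (Finset.sum_nonneg fun i _ => hap i) _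
  have haR : ∀ i ∈ F, |a i| ≤ R := by
    intro i hi
    calc |a i| = (|a i| ^ p) ^ (1 / p) := by
          rw [← Real.rpow_mul (abs_nonneg _), mul_one_div_cancel hp.ne', Real.rpow_one]
      _ ≤ R := Real.rpow_le_rpow (hap i)
          (Finset.single_le_sum (f := fun i => |a i| ^ p) (fun i _ => hap i) hi) (by positivity)
  have hgeom : ∑ i ∈ F, η / 2 / 2 ^ i ≤ η :=
    sum_le_hasSum F (fun i _ => by positivity) (hasSum_geometric_two' η)
  calc ‖∑ i ∈ F, a i • z i - ∑ i ∈ F, a i • u i‖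
      = ‖∑ i ∈ F, a i • (z i - u i)‖ := by
        rw [← Finset.sum_sub_distrib]
        simp only [smul_sub]
    _ ≤ ∑ i ∈ F, R * (η / 2 / 2 ^ i) := by
        refine norm_sum_le_of_le F fun i hi => ?_
        rw [norm_smul, Real.norm_eq_abs]
        exact mul_le_mul (haR i hi) (h i) (norm_nonneg _) hR0
    _ = R * ∑ i ∈ F, η / 2 / 2 ^ i := by rw [Finset.mul_sum]
    _ ≤ R * η := mul_le_mul_of_nonneg_left hgeom hR0
    _ = η * R := mul_comm _ _

theorem coe_sum_smul {k d : ℕ} {θ : Set.Ioo (0 : ℝ) 1} (F : Finset ℕ) (a : ℕ → ℝ)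
    (u : ℕ → C00 k d θ) :
    ‖∑ i ∈ F, a i • (u i : T k d θ)‖ =
      tkNorm k d θ (∑ i ∈ F, a i • (show OmegaEQ k →₀ ℝ from u i)) := by
  have h : ((∑ i ∈ F, a i • u i : C00 k d θ) : T k d θ) = ∑ i ∈ F, a i • (u i : T k d θ) := by
    refine (map_sum (UniformSpace.Completion.toComplL (𝕜 := ℝ) (E := C00 k d θ))
      (fun i => a i • u i) F).trans (Finset.sum_congr rfl fun i _ => ?_)
    rw [map_smul]
    rfl
  rw [← h, UniformSpace.Completion.norm_coe]
  rfl

end HighDimEllentuck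

/-! ### The main theorem -/

theorem mainTheorem3 (k d : ℕ) (hk : 1 ≤ k) (θ : Set.Ioo (0 : ℝ) 1) (hdθ : 1 < (d : ℝ) * (θ : ℝ))
    (p : ℝ) [Fact (1 ≤ ENNReal.ofReal p)] (hp1 : 1 < p)
    (hp : (d : ℝ) * (θ : ℝ) = (d : ℝ) ^ (1 / p))
    (Z : Submodule ℝ (HighDimEllentuck.T k d θ)) (hZc : IsClosed (Z : Set (HighDimEllentuck.T k d θ)))
    (hZ : ¬ FiniteDimensional ℝ Z) :
    ∃ Y : Submodule ℝ (HighDimEllentuck.T k d θ),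
      IsClosed (Y : Set (HighDimEllentuck.T k d θ)) ∧ Y ≤ Z ∧
        Nonempty (Y ≃L[ℝ] lp (fun _ : ℕ => ℝ) (ENNReal.ofReal p)) := by
  open HighDimEllentuck in
  have hp0 : 0 < p := by linarith
  have hθ0 : (0 : ℝ) < θ := θ.2.1
  have hd : 2 ≤ d := by
    by_contra hcon
    have hd1 : (d : ℝ) ≤ 1 := by exact_mod_cast (by omega : d ≤ 1)
    have := θ.2.2
    nlinarith
  have hd0 : (0 : ℝ) < d := by exact_mod_cast (by omega : 0 < d)
  have hθp : (θ : ℝ) = ((d : ℝ)⁻¹) ^ (1 - 1 / p) := by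
    rw [Real.inv_rpow hd0.le, ← Real.rpow_neg hd0.le, neg_sub, Real.rpow_sub hd0, Real.rpow_one,
      ← hp, mul_div_cancel_left₀ _ hd0.ne']
  have hdp : (θ : ℝ) ^ p * (d : ℝ) ^ (p - 1) ≤ 1 := by
    rw [hθp, ← Real.rpow_mul (inv_nonneg.2 hd0.le), sub_mul, one_mul, one_div_mul_cancel hp0.ne',
      ← Real.mul_rpow (inv_nonneg.2 hd0.le) hd0.le, inv_mul_cancel₀ hd0.ne', Real.one_rpow]
  obtain ⟨s, δ, hs, hsk, hδ, hblock⟩ := exists_stem hZ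
  set c : ℝ := ((2 * d : ℝ)⁻¹) ^ (1 - 1 / p) with hc
  have hc0 : 0 < c := Real.rpow_pos_of_pos (by positivity) _
  -- The perturbation may use up half of the lower constant `c * δ`.
  set η : ℝ := c * δ / 2 with hη
  have hη0 : 0 < η := by positivity
  -- Starting at `s.sum` puts every `N i` above all entries of the stem.
  obtain ⟨N, z, u, hNmono, hN0, hzu⟩ := exists_block_sequence hblock s.sum
    (η := fun i => η / 2 / 2 ^ i) (fun i => by positivity)
  have hdiff := norm_sum_sub_sum_le hp0 (z := z) (u := fun i => (u i : T k d θ)) hη0.le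
    fun i => (hzu i).2.2.1
  have huB : ∀ i, tkNorm k d θ (u i) ≤ 1 + η := by
    intro i
    have h1 : tkNorm k d θ (u i) = ‖(u i : T k d θ)‖ := (UniformSpace.Completion.norm_coe (u i)).symm
    have h2 : η / 2 / 2 ^ i ≤ η := by
      have : η / 2 / 2 ^ i ≤ η / 2 := div_le_self (by positivity) (one_le_pow₀ (by norm_num))
      linarith
    rw [h1]
    calc ‖(u i : T k d θ)‖ = ‖z i - (z i - (u i : T k d θ))‖ := by rw [sub_sub_cancel]
      _ ≤ ‖z i‖ + ‖z i - (u i : T k d θ)‖ := norm_sub_le _ _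
      _ ≤ 1 + η := add_le_add (hzu i).2.1.le ((hzu i).2.2.1.trans h2)
  refine exists_submodule_equiv_lp hp0 z (c := c * δ / 2) (C := (θ : ℝ)⁻¹ * 2 * (1 + η) + η)
    (by positivity) (fun F a => ?_) (fun F a => ?_) Z hZc fun i => (hzu i).1
  · have h1 := le_tkNorm_sum_of_blocks hk θ.2 hd hp1 hθp hs hsk hNmono
      (fun a ha => by rw [hN0]; exact List.le_sum_of_mem ha) (fun i => (hzu i).2.2.2.1) hδ.le
      (fun i => (hzu i).2.2.2.2) F a
    have h2 := hdiff F a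
    rw [← coe_sum_smul F a u] at h1
    have h3 := norm_sub_norm_le (∑ i ∈ F, a i • (u i : T k d θ)) (∑ i ∈ F, a i • z i)
    rw [norm_sub_rev] at h3
    rw [← hc, ← mul_assoc] at h1
    have h4 : c * δ * (∑ i ∈ F, |a i| ^ p) ^ (1 / p) =
      c * δ / 2 * (∑ i ∈ F, |a i| ^ p) ^ (1 / p) + η * (∑ i ∈ F, |a i| ^ p) ^ (1 / p) := by
      rw [hη]; ring
    linarith
  · have h1 := tkNorm_sum_le_of_blocks hk θ.2 hp1 hdp hNmono (fun i => (hzu i).2.2.2.1)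
      (by positivity) huB F a
    have h2 := hdiff F a
    rw [← coe_sum_smul F a u] at h1
    have h3 := norm_sub_norm_le (∑ i ∈ F, a i • z i) (∑ i ∈ F, a i • (u i : T k d θ))
    rw [← mul_assoc] at h1
    rw [add_mul]
    linarith
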